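/- Consider binary constraint satisfaction problems (CSPs) $(N,D,C)$ with $N=\{v_1,\dots,v_n\}$, a finite domain $D_i$ for each variable, and at most one constraint $c_{ij}\subseteq D_i\times D_j$ on each pair of distinct variables, where $c_{ij}$ and $c_{ji}$ are the same constraint read in the two directions. A constraint $c_{ij}$ is functional (on $j$) if each $a\in D_i$ is related to at most one $b\in D_j$, and bi-functional if both $c_{ij}$ and $c_{ji}$ are functional. The size of the CSP is the number of variables plus the number of constraints plus the total number of tuples in the constraints. The algorithm Linear_Elimination works as follows. Let $C^0$ be the original $C$. (1) Let $P^F$ be the directed graph on $N$ with an arc $(i,j)$ whenever $c^0_{ij}\in C^0$ is functional on $j$. Compute an ordering $O$ of $N$ that lists the strongly connected components of $P^F$ one after the other, in a topological order of the components. Mark all variables as not eliminated. (2) Take the variables $i$ of $O$ in order, skipping those marked as eliminated. For each such $i$ let $L=\{j : c_{ij}\in C,\ c^0_{ij}\in C^0 \text{ functional on } j\}$. While $L\neq\emptyset$, take and delete some $j$ from $L$. For every $k\ne i$ with $c_{jk}\in C$, replace $c_{ik}$ by $(c_{jk}\circ c_{ij})\cap c_{ik}$ (where $c_{ik}$ is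 universal if absent), delete $c_{jk}$ from $C$, and if $c^0_{jk}\in C^0$ is functional on $k$, add $k$ to $L$. Then mark $j$ as eliminated. Here $c_{jk}\circ c_{ij}=\{(a,c) : \exists b,\ (a,b)\in c_{ij},\ (b,c)\in c_{jk}\}$. It is intersected with $c_{ik}$ by enumerating, for each $(b,c)\in c_{jk}$, the values $a$ with $(a,b)\in c_{ij}$, and testing $(a,c)\in c_{ik}$. The graph $P^F$ is computed by scanning the tuples of all constraints, and $O$ by two depth-first searches. Running time is counted in elementary steps. Testing whether a tuple belongs to a constraint, inserting a tuple, moving to the next tuple, to the next constraint on a variable, or to the next value related to a given value, and the elementary operations on lists, sets and tables each take constant time. All choices left open (the order of enumerations, the element taken from $L$) are arbitrary. Then there is a constant $K$, independent of the CSP, such that: (a) if $c_{ij}$ is bi-functional, computing $(c_{jk}\circ c_{ij})\cap c_{ik}$ takes at most $K(|c_{ij}|+|c_{jk}|+1)$ steps; (b) for every CSP in which every functional constraint is bi-functional (the other constraints being arbitrary non-functional ones), every execution of Linear_Elimination terminates after at most $K(S+1)$ steps, where $S$ is the size of the CSP. That is, the worst case running time of Linear_Elimination is linear in the problem size. -/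

import Mathlib

/-! ### Binary constraint satisfaction problems -/

/-- A binary constraint `r`, seen as a set of allowed tuples `(a, b)`, is functional (on its second
variable): every `a` is related to at most one `b`. -/
def IsFunctional {α : Type} (r : Finset (α × α)) : Prop :=
  ∀ a b b', (a, b) ∈ r → (a, b') ∈ r → b = b'

/-- A binary constraint is bi-functional: it is functional on each of its two variables. -/
def IsBifunctional {α : Type} (r : Finset (α × α)) : Prop :=
  IsFunctional r ∧ ∀ a a' b, (a, b) ∈ r → (a', b) ∈ r → a = a'

/-- A binary CSP `(N, D, C)` with variables `N = {0, …, n - 1}`, a finite domain for each variable,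
and at most one constraint on every pair of distinct variables.  `con i j = some r` means that
`c_ij ∈ C` and `c_ij = r`; `con i j = none` means that there is no constraint on `i` and `j`.
The same constraint can be read as `c_ij` and as `c_ji`. -/
structure CSP (n : ℕ) (α : Type) where
  dom : Fin n → Finset α
  con : Fin n → Fin n → Option (Finset (α × α))
  con_self : ∀ i, con i i = none
  con_subset : ∀ i j r, con i j = some r → r ⊆ dom i ×ˢ dom j
  con_symm : ∀ i j, con j i = (con i j).map (Finset.map (Equiv.prodComm α α).toEmbedding)

/-- The size of a CSP: the number of variables, plus the number of constraints, plus the total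
number of tuples of the constraints (each constraint is counted once, at `i < j`). -/
def CSP.size {n : ℕ} {α : Type} (P : CSP n α) : ℕ :=
  n + ∑ p ∈ (Finset.univ : Finset (Fin n × Fin n)).filter (fun p => p.1 < p.2),
    (P.con p.1 p.2).elim 0 (fun r => r.card + 1)

/-! ### Nondeterministic imperative programs and their running time -/

/-- Imperative programs over a store `σ`.  `act f` is an elementary update of the store,
`pick S body` takes an arbitrary element `x` of the set `S` (evaluated in the current store) and
goes on with `body x`, `forEach S body` runs `body x` for the elements `x` of the finite set `S`
(evaluated when the loop is entered), in an arbitrary order. -/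
inductive Prog (σ : Type) : Type 1 where
  | skip : Prog σ
  | act (f : σ → σ) : Prog σ
  | seq (p q : Prog σ) : Prog σ
  | ite (b : σ → Prop) (p q : Prog σ) : Prog σ
  | loop (b : σ → Prop) (p : Prog σ) : Prog σ
  | pick {β : Type} (S : σ → Set β) (body : β → Prog σ) : Prog σ
  | forEach {β : Type} (S : σ → Finset β) (body : β → Prog σ) : Prog σ

/-- Sequential composition of a list of programs. -/
def Prog.block {σ : Type} (l : List (Prog σ)) : Prog σ :=
  l.foldr Prog.seq Prog.skip

/-- `Prog.Step p s p' s'`: one computation step leads from program `p` in store `s` to the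
remaining program `p'` in store `s'`.  Every elementary update, test of a condition, choice,
passage to the next element of a `forEach` and passage to the next command is one step. -/
inductive Prog.Step {σ : Type} : Prog σ → σ → Prog σ → σ → Prop where
  | act (f : σ → σ) (s : σ) : Prog.Step (.act f) s .skip (f s)
  | seqStep (p p' q : Prog σ) (s s' : σ) :
      Prog.Step p s p' s' → Prog.Step (.seq p q) s (.seq p' q) s'
  | seqSkip (q : Prog σ) (s : σ) : Prog.Step (.seq .skip q) s q s
  | iteTrue (b : σ → Prop) (p q : Prog σ) (s : σ) : b s → Prog.Step (.ite b p q) s p s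
  | iteFalse (b : σ → Prop) (p q : Prog σ) (s : σ) : ¬ b s → Prog.Step (.ite b p q) s q s
  | loopTrue (b : σ → Prop) (p : Prog σ) (s : σ) :
      b s → Prog.Step (.loop b p) s (.seq p (.loop b p)) s
  | loopFalse (b : σ → Prop) (p : Prog σ) (s : σ) : ¬ b s → Prog.Step (.loop b p) s .skip s
  | pick {β : Type} (S : σ → Set β) (body : β → Prog σ) (s : σ) (x : β) :
      x ∈ S s → Prog.Step (.pick S body) s (body x) s
  | forEach {β : Type} (S : σ → Finset β) (body : β → Prog σ) (s : σ) (l : List β) :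
      l.Nodup → (∀ x, x ∈ l ↔ x ∈ S s) →
        Prog.Step (.forEach S body) s (Prog.block (l.map body)) s

/-- `Prog.HaltsWithin p s T`: whatever choices are made, the execution of `p` from the store `s`
never gets stuck and terminates after at most `T` steps.  In other words, the worst case running
time of `p` from `s` is at most `T`. -/
inductive Prog.HaltsWithin {σ : Type} : Prog σ → σ → ℕ → Prop where
  | done (s : σ) (T : ℕ) : Prog.HaltsWithin .skip s T
  | step (p : Prog σ) (s : σ) (T : ℕ) :
      (∃ p' s', Prog.Step p s p' s') →
      (∀ p' s', Prog.Step p s p' s' → Prog.HaltsWithin p' s' T) →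
        Prog.HaltsWithin p s (T + 1)

/-! ### The data of the elimination algorithm -/

/-- The store of the elimination algorithm.  Sets and tables have the usual unit-cost operations
(membership test, look-up of an entry, insertion, deletion, emptying, emptiness test, access to
some element, start of an enumeration).  A constraint is stored with its tuples and, for every
value of one variable, with the list of the related values of the other one, so that in particular
testing a tuple, and finding the support of a value in a functional constraint, take constant
time.  For every variable there is a list of the constraints on it. -/
structure Store (n : ℕ) (α : Type) where
  /-- the current set `C` of constraints, `C i j` being `c_ij` -/
  C : Fin n → Fin n → Option (Finset (α × α))
  /-- the arcs `(i, j)` such that `c_ij` is in the original `C` and functional on `j` -/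
  func : Finset (Fin n × Fin n)
  /-- work space for testing whether a constraint is functional -/
  seen : Finset α
  /-- work space for testing whether a constraint is functional -/
  flag : Prop
  /-- depth-first search: the vertices visited so far -/
  visited : Finset (Fin n)
  /-- depth-first search: the stack of the open vertices -/
  stack : List (Fin n)
  /-- depth-first search: the neighbours of an open vertex that have not been looked at yet -/
  pending : Fin n → Finset (Fin n)
  /-- depth-first search: the finished vertices, the last one first -/
  finished : List (Fin n)
  /-- the start vertices for the second depth-first search -/
  starts : List (Fin n)
  /-- the elimination ordering `O` -/
  O : List (Fin n)
  /-- the variables that are marked as eliminated -/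
  elim : Finset (Fin n)
  /-- the work list `L` -/
  L : Finset (Fin n)
  /-- the constraint under construction in a composition -/
  acc : Finset (α × α)

namespace Store

variable {n : ℕ} {α : Type}

/-- The tuples of the current constraint `c_ij`. -/
def tuples (s : Store n α) (i j : Fin n) : Finset (α × α) := (s.C i j).getD ∅

/-- The variables `k` such that `c_jk` is in the current `C`. -/
def nbrs (s : Store n α) (j : Fin n) : Finset (Fin n) :=
  Finset.univ.filter fun k => (s.C j k).isSome = true

/-- The values `a` with `(a, b) ∈ c_ij`. -/
def supports [DecidableEq α] (s : Store n α) (i j : Fin n) (b : α) : Finset α :=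
  ((s.tuples i j).filter fun t => t.2 = b).image Prod.fst

/-- The pair `(a, c)` is allowed for the variables `i` and `k`; if there is no constraint `c_ik`,
this is the universal relation. -/
def allowed (s : Store n α) (i k : Fin n) (a c : α) : Prop :=
  ∀ r, s.C i k = some r → (a, c) ∈ r

/-- The entry of the table `C` for the unordered pair `{i, k}` becomes `r`, read as `c_ik`. -/
def setCon (s : Store n α) (i k : Fin n) (r : Option (Finset (α × α))) : Store n α :=
  { s with C := fun x y =>
      if x = i ∧ y = k then r
      else if x = k ∧ y = i then r.map (Finset.map (Equiv.prodComm α α).toEmbedding)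
      else s.C x y }

/-- The successors of `i` in the directed graph of the functional constraints. -/
def succs (s : Store n α) (i : Fin n) : Finset (Fin n) :=
  Finset.univ.filter fun j => (i, j) ∈ s.func

/-- The predecessors of `j` in the directed graph of the functional constraints. -/
def preds (s : Store n α) (j : Fin n) : Finset (Fin n) :=
  Finset.univ.filter fun i => (i, j) ∈ s.func

/-- The store at the start of the algorithm: the given constraints, everything else is empty. -/
def initial (P : CSP n α) : Store n α where
  C := P.con
  func := ∅
  seen := ∅
  flag := True
  visited := ∅
  stack := []
  pending := fun _ => ∅
  finished := []
  starts := []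
  O := []
  elim := ∅
  L := ∅
  acc := ∅

end Store

/-! ### The algorithm `Linear_Elimination` -/

namespace LinearElimination

open Prog

variable {n : ℕ} {α : Type}

/-- Find the arcs `(i, j)` such that `c_ij` is in `C` and functional on `j`.  A constraint is
functional if no value occurs twice as the first entry of one of its (distinct) tuples. -/
def markFunctional [DecidableEq α] : Prog (Store n α) :=
  forEach (fun _ => (Finset.univ : Finset (Fin n))) fun i =>
    forEach (fun s => s.nbrs i) fun j =>
      block [
        act (fun s => { s with seen := ∅, flag := True }),
        forEach (fun s => s.tuples i j) (fun t =>
          ite (fun s => t.1 ∈ s.seen)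
            (act (fun s => { s with flag := False }))
            (act (fun s => { s with seen := insert t.1 s.seen }))),
        ite (fun s => s.flag)
          (act (fun s => { s with func := insert (i, j) s.func }))
          skip]

/-- Depth-first search from the vertex `r` in the graph with neighbour lists `adj`, unless `r` has
been visited before.  Finished vertices are put in front of the list `finished`. -/
def depthFirst (adj : Store n α → Fin n → Finset (Fin n)) (r : Fin n) : Prog (Store n α) :=
  ite (fun s => r ∈ s.visited) skip (block [
    act (fun s => { s with visited := insert r s.visited }),
    act (fun s => { s with pending := Function.update s.pending r (adj s r) }),
    act (fun s => { s with stack := [r] }),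
    loop (fun s => s.stack ≠ []) (
      pick (fun s => {v | s.stack.head? = some v}) fun v =>
        ite (fun s => (s.pending v).Nonempty)
          (pick (fun s => {w | w ∈ s.pending v}) fun w =>
            block [
              act (fun s => { s with
                pending := Function.update s.pending v ((s.pending v).erase w) }),
              ite (fun s => w ∈ s.visited) skip (block [
                act (fun s => { s with visited := insert w s.visited }),
                act (fun s => { s with pending := Function.update s.pending w (adj s w) }),
                act (fun s => { s with stack := w :: s.stack })])])
          (block [
            act (fun s => { s with stack := s.stack.tail }),
            act (fun s => { s with finished := v :: s.finished })]))])

/-- Find a functional elimination ordering: an ordering of the variables in which the strongly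
connected components of the directed graph of the functional constraints come one after the other,
in a topological order of the components.  (The components are found by two depth-first searches,
first along the reversed arcs, then, by decreasing finishing time, along the arcs; the second search
completes the components in the reverse of a topological order.) -/
def findOrdering : Prog (Store n α) :=
  block [
    act (fun s => { s with visited := ∅ }),
    act (fun s => { s with finished := [] }),
    forEach (fun _ => (Finset.univ : Finset (Fin n))) (fun r => depthFirst Store.preds r),
    act (fun s => { s with starts := s.finished }),
    act (fun s => { s with visited := ∅ }),
    act (fun s => { s with finished := [] }),
    loop (fun s => s.starts ≠ []) (
      pick (fun s => {r | s.starts.head? = some r}) fun r =>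
        block [
          act (fun s => { s with starts := s.starts.tail }),
          depthFirst Store.succs r]),
    act (fun s => { s with O := s.finished })]

/-- `c'_ik ← (c_jk ∘ c_ij) ∩ c_ik`, put into `C` in the place of `c_ik`: for every `(b, c) ∈ c_jk`
and every `a` with `(a, b) ∈ c_ij`, the tuple `(a, c)` is put into `c'_ik` if `c_ik` allows it. -/
def compose [DecidableEq α] (i j k : Fin n) : Prog (Store n α) :=
  block [
    act (fun s => { s with acc := ∅ }),
    forEach (fun s => s.tuples j k) (fun t =>
      forEach (fun s => s.supports i j t.1) fun a =>
        ite (fun s => s.allowed i k a t.2)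
          (act (fun s => { s with acc := insert (a, t.2) s.acc }))
          skip),
    act (fun s => s.setCon i k (some s.acc))]

/-- Substitute `j` by `i` in `c_jk`: put `(c_jk ∘ c_ij) ∩ c_ik` into `C` and delete `c_jk`; if the
original `c_jk` is functional, put `k` into the work list. -/
def substitute [DecidableEq α] (i j k : Fin n) : Prog (Store n α) :=
  block [
    compose i j k,
    act (fun s => s.setCon j k none),
    ite (fun s => (j, k) ∈ s.func)
      (act (fun s => { s with L := insert k s.L }))
      skip]

/-- Eliminate, by means of `i`, all the variables that are reachable from `i` through qualified
constraints. -/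
def process [DecidableEq α] (i : Fin n) : Prog (Store n α) :=
  block [
    act (fun s => { s with L := ∅ }),
    forEach (fun s => s.nbrs i) (fun j =>
      ite (fun s => (i, j) ∈ s.func)
        (act (fun s => { s with L := insert j s.L }))
        skip),
    loop (fun s => s.L.Nonempty) (
      pick (fun s => {j | j ∈ s.L}) fun j =>
        block [
          act (fun s => { s with L := s.L.erase j }),
          forEach (fun s => (s.nbrs j).erase i) (fun k => substitute i j k),
          act (fun s => { s with elim := insert j s.elim })])]

/-- The algorithm `Linear_Elimination`. -/
def algorithm [DecidableEq α] : Prog (Store n α) :=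
  block [
    markFunctional,
    findOrdering,
    forEach (fun _ => (Finset.univ : Finset (Fin n))) (fun i =>
      act (fun s => { s with elim := s.elim.erase i })),
    loop (fun s => s.O ≠ []) (
      pick (fun s => {i | s.O.head? = some i}) fun i =>
        block [
          act (fun s => { s with O := s.O.tail }),
          ite (fun s => i ∈ s.elim) skip (process i)])]

end LinearElimination

/-! ### A program logic with time credits -/

/-! Why the time is linear. If `c_ij` is bi-functional, each value `b` has at most one support `a`,
so a composition spends constant time on each tuple of `c_jk`. This gives (a). Moreover `(a, c) ↦
(b, c)` embeds the result into `c_jk`, so the new `c_ik` has no more tuples than the deleted `c_jk`.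

For (b), call a variable touched once it has served as a root `i` or has been taken from `L`. The
functional arcs are symmetric, so between two roots the touched variables are closed under these
arcs. A new root therefore meets only untouched functional neighbours, whose original constraints
are intact. Every `j` in `L` is untouched and has a bi-functional `c_ij`: this relation arises by
composing bi-functional constraints, and intersecting keeps it bi-functional.

Replacing `c_jk` by the new `c_ik` deletes one constraint at `k` and puts a constraint of at most
the same weight in the place of the old `c_ik`. The weighted degree (`conDegree`) of an untouched
variable thus never increases (`conDegree_substCon_le`). The degree of `i` may grow, but `i` has
already been paid for. Each variable is touched once, at a cost proportional to its degree at that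
moment, so the total is bounded by the sum of the original degrees, which is at most twice the size.
About the ordering `O`, this bound needs only that it has no repetitions.

The amortization is carried out in a program logic with time credits: invariants bound the available
credits below by a potential. The depth-first searches use `vertexPotential`, the elimination uses
`elimPotential`; the combinatorial invariant of the latter is `ProcInv`. -/

namespace Prog

variable {σ : Type}

/-- `Runs Q p s T`: with `T` time credits, `p` terminates from `s` whatever choices are made, and
the final store together with some amount of credits that are left over satisfies `Q`. -/
inductive Runs (Q : σ → ℕ → Prop) : Prog σ → σ → ℕ → Prop where
  | done (s : σ) (t T : ℕ) : t ≤ T → Q s t → Runs Q .skip s T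
  | step (p : Prog σ) (s : σ) (T : ℕ) :
      (∃ p' s', Step p s p' s') → (∀ p' s', Step p s p' s' → Runs Q p' s' T) → Runs Q p s (T + 1)

namespace Runs

variable {Q Q' : σ → ℕ → Prop} {p q : Prog σ} {s : σ} {T T' : ℕ}

theorem haltsWithin (h : Runs Q p s T) : HaltsWithin p s T := by
  induction h with
  | done s t T _ _ => exact .done s T
  | step p s T he _ ih => exact .step p s T he ih

theorem mono (h : Runs Q p s T) (hT : T ≤ T') : Runs Q p s T' := by
  induction h generalizing T' with
  | done s t T ht hQ => exact .done s t T' (ht.trans hT) hQ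
  | step p s T he _ ih =>
    obtain ⟨T', rfl⟩ : ∃ u, T' = u + 1 := ⟨T' - 1, by omega⟩
    exact .step p s T' he fun p' s' hs => ih p' s' hs (by omega)

theorem weaken (h : Runs Q p s T) (hQ : ∀ s' t, Q s' t → ∃ t' ≤ t, Q' s' t') : Runs Q' p s T := by
  induction h with
  | done s t T ht h =>
    obtain ⟨t', ht', h'⟩ := hQ s t h
    exact .done s t' T (ht'.trans ht) h'
  | step p s T he _ ih => exact .step p s T he ih

/-- The frame rule: unused credits are kept. -/
theorem frame (F : ℕ) (h : Runs Q p s T) (hQ : ∀ s' t, t ≤ T → Q s' t → Q' s' (t + F)) :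
    Runs Q' p s (T + F) := by
  induction h with
  | done s t T ht h => exact .done s (t + F) _ (by omega) (hQ s t ht h)
  | step p s T he _ ih =>
    rw [Nat.add_right_comm]
    exact .step p s _ he fun p' s' hs => ih p' s' hs fun s'' t ht => hQ s'' t (by omega)

theorem conseq (h : Runs Q p s T) (hQ : ∀ s' t, t ≤ T → Q s' t → Q' s' t) : Runs Q' p s T :=
  h.frame 0 hQ

/-- Use of a specification with a fixed cost. -/
theorem spec {R : σ → Prop} {c : ℕ} (h : Runs (fun s' _ => R s') p s c) (hc : c ≤ T)
    (hQ : ∀ s', R s' → Q s' (T - c)) : Runs Q p s T := by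
  have h1 : Runs (fun s1 t => T - c ≤ t ∧ R s1) p s (c + (T - c)) :=
    h.frame (T - c) fun s1 t _ hR => ⟨by omega, hR⟩
  rw [Nat.add_sub_cancel' hc] at h1
  exact h1.weaken fun s1 t h => ⟨T - c, h.1, hQ s1 h.2⟩

theorem skip (h : Q s T) : Runs Q .skip s T := .done s T T le_rfl h

theorem act {f : σ → σ} (hT : 1 ≤ T) (h : Q (f s) (T - 1)) : Runs Q (.act f) s T := by
  obtain ⟨T, rfl⟩ : ∃ u, T = u + 1 := ⟨T - 1, by omega⟩
  refine .step _ _ _ ⟨_, _, .act f s⟩ fun p' s' hs => ?_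
  cases hs
  exact skip h

/-- The credit demanded between `p` and `q` pays for the step that discards the finished `skip`. -/
theorem seq (h : Runs (fun s' t => 1 ≤ t ∧ Runs Q q s' (t - 1)) p s T) :
    Runs Q (.seq p q) s T := by
  induction h with
  | done s t T ht h =>
    obtain ⟨t, rfl⟩ : ∃ u, t = u + 1 := ⟨t - 1, by omega⟩
    obtain ⟨T, rfl⟩ : ∃ u, T = u + 1 := ⟨T - 1, by omega⟩
    refine .step _ _ _ ⟨_, _, .seqSkip q s⟩ fun p' s' hs => ?_
    cases hs with
    | seqStep _ _ _ _ _ h' => cases h'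
    | seqSkip => exact h.2.mono (by omega)
  | step p s T he h ih =>
    obtain ⟨p₁, s₁, h₁⟩ := he
    refine .step _ _ _ ⟨_, _, .seqStep p p₁ q s s₁ h₁⟩ fun p' s' hs => ?_
    cases hs with
    | seqStep _ p₂ _ _ _ h' => exact ih _ _ h'
    | seqSkip => cases h₁

theorem ite {b : σ → Prop} (hT : 1 ≤ T) (hp : b s → Runs Q p s (T - 1))
    (hq : ¬ b s → Runs Q q s (T - 1)) : Runs Q (.ite b p q) s T := by
  obtain ⟨T, rfl⟩ : ∃ u, T = u + 1 := ⟨T - 1, by omega⟩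
  refine .step _ _ _ ?_ fun p' s' hs => ?_
  · by_cases hb : b s
    · exact ⟨_, _, .iteTrue b p q s hb⟩
    · exact ⟨_, _, .iteFalse b p q s hb⟩
  · cases hs with
    | iteTrue _ _ _ _ hb => exact hp hb
    | iteFalse _ _ _ _ hb => exact hq hb

theorem pick {β : Type} {S : σ → Set β} {body : β → Prog σ} (hT : 1 ≤ T) (hS : (S s).Nonempty)
    (h : ∀ x ∈ S s, Runs Q (body x) s (T - 1)) : Runs Q (.pick S body) s T := by
  obtain ⟨T, rfl⟩ : ∃ u, T = u + 1 := ⟨T - 1, by omega⟩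
  obtain ⟨x, hx⟩ := hS
  refine .step _ _ _ ⟨_, _, .pick S body s x hx⟩ fun p' s' hs => ?_
  cases hs with
  | pick _ _ _ y hy => exact h y hy

/-- No separate variant is needed: each iteration consumes credits, so strong induction on the
credits proves termination. -/
theorem loop {b : σ → Prop} (I : σ → ℕ → Prop) (h0 : I s T)
    (hstep : ∀ s t, I s t → b s →
      1 ≤ t ∧ Runs (fun s' t' => 1 ≤ t' ∧ I s' (t' - 1)) p s (t - 1))
    (hQ : ∀ s t, I s t → ¬ b s → 1 ≤ t ∧ Q s (t - 1)) : Runs Q (.loop b p) s T := by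
  induction T using Nat.strong_induction_on generalizing s with
  | _ T ih =>
    by_cases hb : b s
    · obtain ⟨h1, h2⟩ := hstep s T h0 hb
      obtain ⟨T, rfl⟩ : ∃ u, T = u + 1 := ⟨T - 1, by omega⟩
      refine .step _ _ _ ⟨_, _, .loopTrue b p s hb⟩ fun p' s' hs => ?_
      cases hs with
      | loopTrue =>
        exact seq (h2.conseq fun s' t ht h => ⟨h.1, ih _ (by omega) h.2⟩)
      | loopFalse _ _ _ h => exact absurd hb h
    · obtain ⟨h1, h2⟩ := hQ s T h0 hb
      obtain ⟨T, rfl⟩ : ∃ u, T = u + 1 := ⟨T - 1, by omega⟩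
      refine .step _ _ _ ⟨_, _, .loopFalse b p s hb⟩ fun p' s' hs => ?_
      cases hs with
      | loopTrue _ _ _ h => exact absurd h hb
      | loopFalse => exact skip h2

/-- The invariant is indexed by the set of elements still to be visited, which makes it independent
of the order of enumeration. -/
theorem forEach {β : Type} {S : σ → Finset β} {body : β → Prog σ} (I : Finset β → σ → ℕ → Prop)
    (hT : 1 ≤ T) (h0 : I (S s) s (T - 1))
    (hstep : ∀ x R (hx : x ∉ R) s' t, x ∈ S s → R ⊆ S s → I (Finset.cons x R hx) s' t →
      Runs (fun s'' t' => 1 ≤ t' ∧ I R s'' (t' - 1)) (body x) s' t)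
    (hQ : ∀ s' t, I ∅ s' t → Q s' t) : Runs Q (.forEach S body) s T := by
  obtain ⟨T, rfl⟩ : ∃ u, T = u + 1 := ⟨T - 1, by omega⟩
  -- Some enumeration exists, so the program is not stuck.
  obtain ⟨l₀, hl₀⟩ : ∃ l : List β, l.Nodup ∧ ∀ x, x ∈ l ↔ x ∈ S s :=
    ⟨(S s).toList, (S s).nodup_toList, fun x => Finset.mem_toList⟩
  refine .step _ _ _ ⟨_, _, .forEach S body s l₀ hl₀.1 hl₀.2⟩ fun p' s' hs => ?_
  cases hs with
  | forEach _ _ _ l hl hlS =>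
    have key : ∀ (l : List β) (hl : l.Nodup) (s' : σ) (t : ℕ), (∀ x ∈ l, x ∈ S s) →
        I ⟨l, hl⟩ s' t → Runs Q (block (l.map body)) s' t := by
      intro l
      induction l with
      | nil => exact fun hl s' t _ h => skip (hQ s' t h)
      | cons x l ih =>
        intro hl s' t hlS h
        obtain ⟨hx, hl'⟩ := List.nodup_cons.1 hl
        refine seq ((hstep x ⟨l, hl'⟩ hx s' t (hlS x (by simp))
          (fun y hy => hlS y (List.mem_cons_of_mem _ hy)) h).conseq fun s'' t' _ h' => ⟨h'.1, ?_⟩)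
        exact ih hl' s'' _ (fun y hy => hlS y (List.mem_cons_of_mem _ hy)) h'.2
    refine key l hl s T (fun x hx => (hlS x).1 hx) ?_
    have : (⟨l, hl⟩ : Finset β) = S s := Finset.ext fun x => hlS x
    rw [this]
    exact h0

/-- A `forEach` loop in which the cost of the iteration for `x` is bounded by `c x`. -/
theorem forEach_const {β : Type} {S : σ → Finset β} {body : β → Prog σ} (J : Finset β → σ → Prop)
    (c : β → ℕ) (hT : ∑ x ∈ S s, (c x + 1) + 1 ≤ T) (h0 : J (S s) s)
    (hstep : ∀ x R (hx : x ∉ R) s', x ∈ S s → R ⊆ S s → J (Finset.cons x R hx) s' →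
      Runs (fun s'' _ => J R s'') (body x) s' (c x))
    (hQ : ∀ s', J ∅ s' → Q s' (T - (∑ x ∈ S s, (c x + 1) + 1))) :
    Runs Q (.forEach S body) s T := by
  refine spec (R := J ∅) ?_ hT hQ
  refine forEach (fun R s' t => J R s' ∧ ∑ x ∈ R, (c x + 1) ≤ t) (by omega) ⟨h0, by omega⟩ ?_
    fun s' t h => h.1
  intro x R hx s' t hxS hR ⟨hJ, ht⟩
  rw [Finset.sum_cons] at ht
  exact spec (hstep x R hx s' hxS hR hJ) (by omega) fun s'' h => ⟨by omega, h, by omega⟩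

theorem seq_act {f : σ → σ} (hT : 2 ≤ T) (h : Runs Q q (f s) (T - 2)) :
    Runs Q (.seq (.act f) q) s T :=
  seq (act (by omega) ⟨by omega, by rwa [Nat.sub_sub]⟩)

end Runs

end Prog

/-! ### Weights of constraints and variables -/

/-- The number of tuples of a constraint plus one; `0` for an absent constraint. -/
def conWeight {α : Type} (o : Option (Finset (α × α))) : ℕ := o.elim 0 fun r => r.card + 1

/-- The total weight of the constraints on the variable `i`. -/
def conDegree {n : ℕ} {α : Type} (C : Fin n → Fin n → Option (Finset (α × α))) (i : Fin n) : ℕ :=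
  ∑ j, conWeight (C i j)

namespace Store

variable {n : ℕ} {α : Type}

theorem mem_nbrs {s : Store n α} {i j : Fin n} : j ∈ s.nbrs i ↔ (s.C i j).isSome = true := by
  simp [nbrs]

theorem conWeight_eq_of_mem_nbrs {s : Store n α} {i j : Fin n} (h : j ∈ s.nbrs i) :
    conWeight (s.C i j) = (s.tuples i j).card + 1 := by
  obtain ⟨r, hr⟩ := Option.isSome_iff_exists.1 (mem_nbrs.1 h)
  simp [conWeight, tuples, hr]

theorem sum_nbrs_le (s : Store n α) (i : Fin n) :
    ∑ j ∈ s.nbrs i, ((s.tuples i j).card + 1) ≤ conDegree s.C i := by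
  rw [← Finset.sum_congr rfl fun j hj => conWeight_eq_of_mem_nbrs hj]
  exact Finset.sum_le_sum_of_subset (Finset.subset_univ _)

end Store

namespace LinearElimination

open Prog

variable {n : ℕ} {α : Type}

/-! ### Marking the functional constraints -/

theorem functional_test [DecidableEq α] (s : Store n α) (i j : Fin n) (hs : s.seen = ∅)
    (hf : s.flag) :
    Runs (fun s' _ => s'.C = s.C ∧ s'.elim = s.elim ∧ s'.stack = s.stack ∧ s'.func = s.func ∧
        (s'.flag ↔ IsFunctional (s.tuples i j)))
      (forEach (fun s => s.tuples i j) (fun t =>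
        ite (fun s => t.1 ∈ s.seen)
          (act (fun s => { s with flag := False }))
          (act (fun s => { s with seen := insert t.1 s.seen })))) s
      (3 * (s.tuples i j).card + 1) := by
  -- With `R` the tuples not yet scanned, `seen` holds the first entries of the scanned ones, and
  -- `flag` says that the scanned part is functional.
  refine Runs.forEach_const (fun R s' => s'.C = s.C ∧ s'.elim = s.elim ∧ s'.stack = s.stack ∧ s'.func = s.func ∧
    (∀ a, a ∈ s'.seen ↔ ∃ b, (a, b) ∈ s.tuples i j \ R) ∧
    (s'.flag ↔ IsFunctional (s.tuples i j \ R))) (fun _ => 2) ?_ ?_ ?_ ?_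
  · simp; omega
  · simp [hs, hf, IsFunctional]
  · rintro ⟨a, b⟩ R hx s' hxS hR ⟨hC, hE, hS, hF, hseen, hflag⟩
    have hmem : ∀ t, t ∈ s.tuples i j \ R ↔
        t = (a, b) ∨ t ∈ s.tuples i j \ Finset.cons (a, b) R hx := by
      intro t
      simp only [Finset.mem_sdiff, Finset.mem_cons, not_or]
      constructor
      · rintro ⟨h1, h2⟩
        by_cases ht : t = (a, b)
        · exact Or.inl ht
        · exact Or.inr ⟨h1, ht, h2⟩
      · rintro (rfl | ⟨h1, -, h2⟩)
        · exact ⟨hxS, hx⟩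
        · exact ⟨h1, h2⟩
    have hnot : (a, b) ∉ s.tuples i j \ Finset.cons (a, b) R hx := by simp
    generalize s.tuples i j \ Finset.cons (a, b) R hx = X at *
    generalize s.tuples i j \ R = Y at *
    refine Runs.ite (by omega) (fun h => Runs.act (by omega) ?_)
      (fun h => Runs.act (by omega) ?_)
    · obtain ⟨b', hb'⟩ := (hseen a).1 h
      refine ⟨hC, hE, hS, hF, fun c => ?_, ?_⟩
      · rw [hseen]
        constructor
        · rintro ⟨d, hd⟩
          exact ⟨d, (hmem _).2 (Or.inr hd)⟩
        · rintro ⟨d, hd⟩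
          rcases (hmem _).1 hd with h | h
          · cases h
            exact ⟨b', hb'⟩
          · exact ⟨d, h⟩
      -- Functionality would identify the new tuple `(a, b)` with the scanned tuple `(a, b')`.
      · refine ⟨False.elim, fun hfun => hnot ?_⟩
        rwa [hfun a b b' ((hmem _).2 (Or.inl rfl)) ((hmem _).2 (Or.inr hb'))]
    · have h' : ∀ d, (a, d) ∉ X := fun d hd => h ((hseen a).2 ⟨d, hd⟩)
      refine ⟨hC, hE, hS, hF, fun c => ?_, hflag.trans ⟨fun hfun => ?_, fun hfun => ?_⟩⟩
      · simp only [Finset.mem_insert, hseen]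
        constructor
        · rintro (rfl | ⟨d, hd⟩)
          · exact ⟨b, (hmem _).2 (Or.inl rfl)⟩
          · exact ⟨d, (hmem _).2 (Or.inr hd)⟩
        · rintro ⟨d, hd⟩
          rcases (hmem _).1 hd with h | h
          · cases h
            exact Or.inl rfl
          · exact Or.inr ⟨d, h⟩
      · intro c d d' hd hd'
        rcases (hmem _).1 hd with h1 | h1 <;> rcases (hmem _).1 hd' with h2 | h2
        · cases h1; cases h2; rfl
        · cases h1; exact absurd h2 (h' _)
        · cases h2; exact absurd h1 (h' _)
        · exact hfun c d d' h1 h2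
      · exact fun c d d' hd hd' =>
          hfun c d d' ((hmem _).2 (Or.inr hd)) ((hmem _).2 (Or.inr hd'))
  · rintro s' ⟨hC, hE, hS, hF, -, hflag⟩
    exact ⟨hC, hE, hS, hF, by simpa using hflag⟩

theorem markFunctional_runs [DecidableEq α] (s : Store n α) (hF : s.func = ∅) :
    Runs (fun s' _ => s'.C = s.C ∧ s'.elim = s.elim ∧ s'.stack = s.stack ∧
        ∀ i j, (i, j) ∈ s'.func ↔ ∃ r, s.C i j = some r ∧ IsFunctional r)
      markFunctional s (8 * ∑ i, conDegree s.C i + 2 * n + 1) := by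
  have hsum : ∀ i, ∑ j ∈ s.nbrs i, (3 * (s.tuples i j).card + 7 + 1) ≤ 8 * conDegree s.C i := by
    intro i
    refine le_trans ?_ (Nat.mul_le_mul_left 8 (s.sum_nbrs_le i))
    rw [Finset.mul_sum]
    exact Finset.sum_le_sum fun j _ => by omega
  refine Runs.forEach_const (fun R s' => s'.C = s.C ∧ s'.elim = s.elim ∧ s'.stack = s.stack ∧
      ∀ i j, (i, j) ∈ s'.func ↔ i ∉ R ∧ ∃ r, s.C i j = some r ∧ IsFunctional r)
    (fun i => 8 * conDegree s.C i + 1) ?_ ?_ ?_ ?_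
  · simp only [Finset.sum_add_distrib, ← Finset.mul_sum]
    simp
    omega
  · simp [hF]
  · rintro i R hi s₁ - - ⟨hC, hE, hS, hF⟩
    have hnb : s₁.nbrs i = s.nbrs i := by simp [Store.nbrs, hC]
    refine Runs.forEach_const (fun R' s' => s'.C = s.C ∧ s'.elim = s.elim ∧ s'.stack = s.stack ∧
      ∀ i' j, (i', j) ∈ s'.func ↔ (i' ∉ R ∧ (i' = i → j ∉ R')) ∧
        ∃ r, s.C i' j = some r ∧ IsFunctional r) (fun j => 3 * (s.tuples i j).card + 7)
        ?_ ?_ ?_ ?_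
    · rw [hnb]
      have := hsum i
      omega
    · refine ⟨hC, hE, hS, fun i' j => ?_⟩
      rw [hF]
      refine and_congr_left fun ⟨r, hr, _⟩ => ?_
      have : i' = i → j ∈ s₁.nbrs i := by
        rintro rfl
        simp [Store.mem_nbrs, hC, hr]
      simp only [Finset.mem_cons]
      tauto
    · rintro j R' hj s₂ hjn - ⟨hC, hE, hS, hF⟩
      rw [hnb, Store.mem_nbrs] at hjn
      obtain ⟨r, hr⟩ := Option.isSome_iff_exists.1 hjn
      have htj : s₂.tuples i j = s.tuples i j := by simp [Store.tuples, hC]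
      have htr : s.tuples i j = r := by simp [Store.tuples, hr]
      have htest := functional_test { s₂ with seen := ∅, flag := True } i j rfl trivial
      rw [show Store.tuples { s₂ with seen := ∅, flag := True } i j = r from htj.trans htr]
        at htest
      rw [htr]
      refine Runs.seq_act (by omega) (Runs.seq (htest.spec (by omega) ?_))
      rintro s₃ ⟨hC₃, hE₃, hS₃, hF₃, hflag⟩
      change s₃.func = s₂.func at hF₃
      have hmem : ∀ i' j', ((i', j') = (i, j) ∧ IsFunctional r ∨ (i', j') ∈ s₂.func) ↔
          (i' ∉ R ∧ (i' = i → j' ∉ R')) ∧ ∃ r, s.C i' j' = some r ∧ IsFunctional r := by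
        intro i' j'
        rw [hF]
        by_cases h : (i', j') = (i, j)
        · cases h
          simp [hr, hi, hj]
        · simp only [h, false_and, false_or, Finset.mem_cons, not_or]
          refine and_congr_left fun _ => and_congr_right fun _ => ?_
          simp only [Prod.mk.injEq, not_and] at h
          tauto
      refine ⟨by omega, Runs.seq (Runs.ite (by omega) (fun h => Runs.act (by omega)
        ⟨by omega, Runs.skip ⟨hC₃.trans hC, hE₃.trans hE, hS₃.trans hS, fun i' j' => ?_⟩⟩)
        (fun h => Runs.skip
          ⟨by omega, Runs.skip ⟨hC₃.trans hC, hE₃.trans hE, hS₃.trans hS, fun i' j' => ?_⟩⟩))⟩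
      · rw [← hmem]
        simp [hF₃, hflag.1 h]
      · rw [← hmem, hF₃]
        exact (or_iff_right fun h' => h (hflag.2 h'.2)).symm
    · rintro s' ⟨hC, hE, hS, hF⟩
      exact ⟨hC, hE, hS, fun i' j => by simp [hF]⟩
  · rintro s' ⟨hC, hE, hS, hF⟩
    exact ⟨hC, hE, hS, fun i j => by simp [hF]⟩

/-! ### Depth-first search -/

/-- The parts of the store that the depth-first search leaves alone, and the well-formedness of the
lists of open and of finished vertices. -/
structure SearchInv (s₀ s : Store n α) : Prop where
  C : s.C = s₀.C
  elim : s.elim = s₀.elim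
  func : s.func = s₀.func
  starts : s.starts = s₀.starts
  nodup : (s.stack ++ s.finished).Nodup
  visited : ∀ v ∈ s.stack ++ s.finished, v ∈ s.visited

/-- The potential of a vertex in the depth-first search: a visited vertex pays for its neighbours
that have not been looked at yet, the other ones for all their neighbours. -/
def vertexPotential (d : Fin n → ℕ) (s : Store n α) (v : Fin n) : ℕ :=
  if v ∈ s.visited then 20 * (s.pending v).card else 20 * d v + 30

/-- Each move of the search changes the potential of a single vertex; `c'` is the amount released.
Additions on both sides avoid truncated subtraction. -/
theorem sum_vertexPotential_le (d : Fin n → ℕ) {s s' : Store n α} (v : Fin n) (c c' : ℕ)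
    (hv : vertexPotential d s' v + c' ≤ vertexPotential d s v + c)
    (h : ∀ w, w ≠ v → vertexPotential d s' w = vertexPotential d s w) :
    ∑ w, vertexPotential d s' w + c' ≤ ∑ w, vertexPotential d s w + c := by
  have h₁ : _ + ∑ w ∈ Finset.univ.erase v, vertexPotential d s w = ∑ w, vertexPotential d s w :=
    Finset.add_sum_erase _ _ (Finset.mem_univ v)
  have h₂ : _ + ∑ w ∈ Finset.univ.erase v, vertexPotential d s' w = ∑ w, vertexPotential d s' w :=
    Finset.add_sum_erase _ _ (Finset.mem_univ v)
  have h₃ : ∑ w ∈ Finset.univ.erase v, vertexPotential d s' w =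
      ∑ w ∈ Finset.univ.erase v, vertexPotential d s w :=
    Finset.sum_congr rfl fun w hw => h w (Finset.ne_of_mem_erase hw)
  omega

/-- Looking at a neighbour removes it from a pending set and releases 20 credits. Visiting a vertex
releases 30, of which 10 stay with its stack entry to pay for popping it. `X` is a reserve for the
caller. Only unvisited vertices are pushed, so open and finished vertices stay distinct. -/
theorem depthFirst_runs {adj : Store n α → Fin n → Finset (Fin n)} {d : Fin n → ℕ}
    {s₀ s : Store n α} (hd : ∀ s, s.func = s₀.func → ∀ v, (adj s v).card ≤ d v) {r : Fin n}
    (hs : SearchInv s₀ s) (hst : s.stack = []) {Q : Store n α → ℕ → Prop} {T X : ℕ}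
    (hT : ∑ v, vertexPotential d s v + X + 1 ≤ T)
    (hQ : ∀ s' t, SearchInv s₀ s' → s'.stack = [] → ∑ v, vertexPotential d s' v + X ≤ t →
      Q s' t) : Runs Q (depthFirst adj r) s T := by
  refine Runs.ite (by omega) (fun _ => Runs.skip (hQ s _ hs hst (by omega))) fun hr => ?_
  have hnd : s.finished.Nodup := by simpa [hst] using hs.nodup
  have hfr : r ∉ s.finished := fun h => hr (hs.visited r (by simp [h]))
  have hpot : 30 ≤ ∑ v, vertexPotential d s v := by
    refine le_trans ?_ (Finset.single_le_sum (fun v _ => Nat.zero_le _) (Finset.mem_univ r))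
    simp [vertexPotential, hr]
  refine Runs.seq_act (by omega) (Runs.seq_act (by omega) (Runs.seq_act (by omega) ?_))
  refine Runs.seq (Runs.loop (fun s t => SearchInv s₀ s ∧
    ∑ v, vertexPotential d s v + 10 * s.stack.length + X + 2 ≤ t) ⟨?_, ?_⟩ ?_ ?_)
  · constructor
    · exact hs.C
    · exact hs.elim
    · exact hs.func
    · exact hs.starts
    · simp [hnd, hfr]
    · intro v hv
      simp only [List.cons_append, List.nil_append, List.mem_cons] at hv
      simp only [Finset.mem_insert]
      exact hv.imp id fun h => hs.visited v (by simp [h])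
  · set s' : Store n α := { s with
      visited := insert r s.visited,
      pending := Function.update s.pending r (adj { s with visited := insert r s.visited } r),
      stack := [r] } with hs'
    have := sum_vertexPotential_le d (s := s) (s' := s') r 0 30 ?_ ?_
    · change ∑ v, vertexPotential d s' v + 10 * 1 + X + 2 ≤ _
      omega
    · have := hd { s with visited := insert r s.visited } hs.func r
      simp only [vertexPotential, hs', Finset.mem_insert_self, if_true, Function.update_self,
        if_neg hr]
      omega
    · intro w hw
      simp [vertexPotential, hs', hw]
  · rintro s₁ t ⟨hs₁, ht⟩ hne
    obtain ⟨v, l, hvl⟩ := List.exists_cons_of_ne_nil hne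
    have hlen : s₁.stack.length = l.length + 1 := by simp [hvl]
    have hnd := hs₁.nodup
    have hvis := hs₁.visited
    rw [hvl] at hnd hvis
    refine ⟨by omega, Runs.pick (by omega) ⟨v, by simp [hvl]⟩ fun v' hv' => ?_⟩
    obtain rfl : v = v' := by simpa [hvl, eq_comm] using hv'
    refine Runs.ite (by omega) (fun hp => ?_) fun hp => ?_
    · have hpot : 20 ≤ ∑ v, vertexPotential d s₁ v := by
        refine le_trans ?_ (Finset.single_le_sum (fun v _ => Nat.zero_le _) (Finset.mem_univ v))
        have := hp.card_pos
        simp only [vertexPotential, hvis v (by simp), if_true]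
        omega
      refine Runs.pick (by omega) hp fun w hw => ?_
      refine Runs.seq_act (by omega) ?_
      set s₂ : Store n α := { s₁ with
        pending := Function.update s₁.pending v ((s₁.pending v).erase w) } with hs₂
      have hpot₂ := sum_vertexPotential_le d (s := s₁) (s' := s₂) v 0 20 (by
        have h1 := Finset.card_erase_add_one hw
        simp only [vertexPotential, hs₂, hvis v (by simp), if_true, Function.update_self]
        omega) (by
        intro u hu
        simp [vertexPotential, hs₂, hu])
      refine Runs.seq (Runs.ite (by omega) (fun hwv => Runs.skip ⟨by omega, Runs.skip
        ⟨by omega, ⟨hs₁.C, hs₁.elim, hs₁.func, hs₁.starts, hs₁.nodup, hs₁.visited⟩, ?_⟩⟩)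
        fun hwv => ?_)
      · change _ + 10 * s₁.stack.length + X + 2 ≤ _
        omega
      · have hwv' : w ∉ v :: l ++ s₁.finished := fun h => hwv (hvis w h)
        refine Runs.seq_act (by omega) (Runs.seq_act (by omega) (Runs.seq_act (by omega)
          (Runs.skip ⟨by omega, Runs.skip ⟨by omega, ⟨hs₁.C, hs₁.elim, hs₁.func, hs₁.starts,
          ?_, ?_⟩, ?_⟩⟩)))
        · change (w :: s₁.stack ++ s₁.finished).Nodup
          rw [hvl, List.cons_append, List.nodup_cons]
          exact ⟨hwv', hnd⟩
        · intro u hu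
          change u ∈ w :: (s₁.stack ++ s₁.finished) at hu
          change u ∈ insert w s₁.visited
          rw [Finset.mem_insert]
          exact (List.mem_cons.1 hu).imp id (hs₁.visited u)
        · set s₃ : Store n α := { s₂ with
            visited := insert w s₂.visited,
            pending := Function.update s₂.pending w
              (adj { s₂ with visited := insert w s₂.visited } w),
            stack := w :: s₂.stack } with hs₃
          have hpot₃ := sum_vertexPotential_le d (s := s₂) (s' := s₃) w 0 30 (by
            have := hd { s₂ with visited := insert w s₂.visited } hs₁.func w
            simp only [vertexPotential, hs₃, Finset.mem_insert_self, if_true,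
              Function.update_self, if_neg hwv]
            omega) (by
            intro u hu
            simp [vertexPotential, hs₃, hu])
          change ∑ v, vertexPotential d s₃ v + 10 * (s₁.stack.length + 1) + X + 2 ≤ _
          omega
    · refine Runs.seq_act (by omega) (Runs.seq_act (by omega) (Runs.skip ⟨by omega,
        ⟨hs₁.C, hs₁.elim, hs₁.func, hs₁.starts, ?_, ?_⟩, ?_⟩))
      · change (s₁.stack.tail ++ v :: s₁.finished).Nodup
        rw [hvl, List.tail_cons, List.nodup_middle]
        exact hnd
      · intro u hu
        change u ∈ s₁.stack.tail ++ v :: s₁.finished at hu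
        change u ∈ s₁.visited
        rw [hvl] at hu
        refine hvis u ?_
        simp only [List.tail_cons, List.mem_append, List.mem_cons, List.cons_append] at hu ⊢
        tauto
      · change ∑ u, vertexPotential d s₁ u + 10 * s₁.stack.tail.length + X + 2 ≤ _
        rw [hvl, List.tail_cons]
        omega
  · rintro s₁ t ⟨hs₁, ht⟩ hne
    rw [not_not] at hne
    exact ⟨by omega, by omega, Runs.skip (hQ s₁ _ hs₁ hne (by omega))⟩

theorem findOrdering_runs (s : Store n α) (hst : s.stack = []) (d : Fin n → ℕ)
    (hsucc : ∀ v, (s.succs v).card ≤ d v) (hpred : ∀ v, (s.preds v).card ≤ d v) :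
    Runs (fun s' _ => s'.C = s.C ∧ s'.elim = s.elim ∧ s'.func = s.func ∧ s'.O.Nodup)
      findOrdering s (40 * ∑ v, d v + 70 * n + 30) := by
  -- Pending sets of unvisited vertices do not count, so what the first search leaves in `pending`
  -- is harmless for the second.
  have hpot : ∀ s' : Store n α, s'.visited = ∅ →
      ∑ v, vertexPotential d s' v = 20 * ∑ v, d v + 30 * n := by
    intro s' h
    simp only [vertexPotential, h, Finset.notMem_empty, if_false, Finset.sum_add_distrib,
      ← Finset.mul_sum, Finset.sum_const, Finset.card_univ, Fintype.card_fin, smul_eq_mul]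
    omega
  have hlen : ∀ l : List (Fin n), l.Nodup → l.length ≤ n := fun l hl => by
    simpa using hl.length_le_card
  refine Runs.seq_act (by omega) (Runs.seq_act (by omega) (Runs.seq ?_))
  -- The bracket is saved for the second search: its initial potential `20 * ∑ v, d v + 30 * n`, 7
  -- credits for each of at most `n` start vertices, and a constant.
  refine Runs.forEach (fun R s' t => (SearchInv s s' ∧ s'.stack = []) ∧
    ∑ v, vertexPotential d s' v + 2 * R.card + (20 * ∑ v, d v + 37 * n + 15) ≤ t) (by omega)
    ⟨⟨⟨rfl, rfl, rfl, rfl, by simp [hst], by simp [hst]⟩, hst⟩, ?_⟩ ?_ ?_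
  · rw [hpot _ rfl, Finset.card_univ, Fintype.card_fin]
    omega
  · rintro r R hr s₁ t - - ⟨⟨h₁, hst₁⟩, ht⟩
    rw [Finset.card_cons] at ht
    refine depthFirst_runs (d := d) (X := 2 * R.card + (20 * ∑ v, d v + 37 * n + 15) + 1)
      (s₀ := s) ?_ h₁ hst₁ (by omega) fun s' t' h' hst' ht' => ⟨by omega, ⟨h', hst'⟩, by omega⟩
    intro s' hs' v
    have : s'.preds v = s.preds v := by simp [Store.preds, hs']
    rw [this]; exact hpred v
  · rintro s₁ t ⟨⟨h₁, hst₁⟩, ht⟩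
    have hnd : s₁.finished.Nodup := by simpa [hst₁] using h₁.nodup
    have hlen₁ := hlen _ hnd
    refine ⟨by omega, Runs.seq_act (by omega) (Runs.seq_act (by omega) (Runs.seq_act (by omega)
      -- This loop consumes `starts`, so the reference store follows it.
      (Runs.seq (Runs.loop (fun s' t => (SearchInv { s with starts := s'.starts } s' ∧
        s'.stack = []) ∧
        ∑ v, vertexPotential d s' v + 7 * s'.starts.length + 4 ≤ t)
        ⟨⟨⟨h₁.C, h₁.elim, h₁.func, rfl, ?_, ?_⟩, hst₁⟩, ?_⟩ ?_ ?_))))⟩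
    · simp [hst₁]
    · simp [hst₁]
    · rw [hpot _ rfl]
      change 20 * ∑ v, d v + 30 * n + 7 * s₁.finished.length + 4 ≤ _
      omega
    · rintro s₂ t ⟨⟨h₂, hst₂⟩, ht⟩ hne
      obtain ⟨r, l, hrl⟩ := List.exists_cons_of_ne_nil hne
      have hlen : s₂.starts.length = l.length + 1 := by simp [hrl]
      refine ⟨by omega, Runs.pick (by omega) ⟨r, by simp [hrl]⟩ fun r' hr' => ?_⟩
      refine Runs.seq_act (by omega) (Runs.seq ?_)
      refine depthFirst_runs (d := d) (X := 7 * l.length + 6)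
        (s₀ := { s with starts := s₂.starts.tail }) ?_
        (s := { s₂ with starts := s₂.starts.tail })
        ⟨h₂.C, h₂.elim, h₂.func, rfl, h₂.nodup, h₂.visited⟩ hst₂ ?_ ?_
      · intro s' hs' v
        have : s'.succs v = s.succs v := by
          change s'.func = s.func at hs'
          simp [Store.succs, hs']
        rw [this]; exact hsucc v
      · change ∑ v, vertexPotential d s₂ v + _ + 1 ≤ _
        omega
      · intro s' t' h' hst' ht'
        have hs' : s'.starts = l := by
          rw [h'.starts]
          simp [hrl]
        refine ⟨by omega, Runs.skip ⟨by omega, ⟨⟨h'.C, h'.elim, h'.func, rfl, h'.nodup,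
          h'.visited⟩, hst'⟩, ?_⟩⟩
        rw [hs']
        omega
    · rintro s₂ t ⟨⟨h₂, hst₂⟩, ht⟩ -
      refine ⟨by omega, by omega, Runs.seq_act (by omega) (Runs.skip
        ⟨h₂.C, h₂.elim, h₂.func, ?_⟩)⟩
      simpa [hst₂] using h₂.nodup

end LinearElimination

/-! ### Composition of constraints -/

/-- Every tuple of `r` comes from a tuple of `c_ij` and a tuple of `c_jk`, and `c_ik` allows it. -/
def Store.IsComposition {n : ℕ} {α : Type} (s : Store n α) (i j k : Fin n)
    (r : Finset (α × α)) : Prop :=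
  ∀ a c, (a, c) ∈ r → (∃ b, (a, b) ∈ s.tuples i j ∧ (b, c) ∈ s.tuples j k) ∧ s.allowed i k a c

theorem IsBifunctional.subset {α : Type} {r r' : Finset (α × α)} (h : IsBifunctional r)
    (hr : ∀ a b, (a, b) ∈ r' → (a, b) ∈ r) : IsBifunctional r' :=
  ⟨fun a b b' h₁ h₂ => h.1 a b b' (hr _ _ h₁) (hr _ _ h₂),
    fun a a' b h₁ h₂ => h.2 a a' b (hr _ _ h₁) (hr _ _ h₂)⟩

namespace Store.IsComposition

variable {n : ℕ} {α : Type} {s : Store n α} {i j k : Fin n} {r : Finset (α × α)}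

/-- Choose a witness `b` for each `(a, c)`. The map `(a, c) ↦ (b, c)` into `c_jk` is injective
because `b` determines `a`. -/
theorem card_le (h : s.IsComposition i j k r) (hij : IsBifunctional (s.tuples i j)) :
    r.card ≤ (s.tuples j k).card := by
  have h' : ∀ p : α × α, ∃ b, p ∈ r → (p.1, b) ∈ s.tuples i j ∧ (b, p.2) ∈ s.tuples j k := by
    intro p
    by_cases hp : p ∈ r
    · obtain ⟨b, hb⟩ := (h p.1 p.2 hp).1
      exact ⟨b, fun _ => hb⟩
    · exact ⟨p.1, fun h => absurd h hp⟩
  choose b hb using h'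
  refine Finset.card_le_card_of_injOn (fun p => (b p, p.2)) (fun p hp => (hb p hp).2) ?_
  intro p hp q hq hpq
  obtain ⟨h₁, h₂⟩ := Prod.mk.inj hpq
  refine Prod.ext (hij.2 _ _ (b p) (hb p hp).1 ?_) h₂
  rw [h₁]
  exact (hb q hq).1

theorem isBifunctional (h : s.IsComposition i j k r) (hij : IsBifunctional (s.tuples i j))
    (hjk : IsBifunctional (s.tuples j k)) : IsBifunctional r := by
  constructor
  · intro a c c' h₁ h₂
    obtain ⟨⟨b, hb₁, hb₂⟩, -⟩ := h a c h₁
    obtain ⟨⟨b', hb₁', hb₂'⟩, -⟩ := h a c' h₂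
    obtain rfl := hij.1 a b b' hb₁ hb₁'
    exact hjk.1 b c c' hb₂ hb₂'
  · intro a a' c h₁ h₂
    obtain ⟨⟨b, hb₁, hb₂⟩, -⟩ := h a c h₁
    obtain ⟨⟨b', hb₁', hb₂'⟩, -⟩ := h a' c h₂
    obtain rfl := hjk.2 b b' c hb₂ hb₂'
    exact hij.2 a a' b hb₁ hb₁'

end Store.IsComposition

namespace LinearElimination

open Prog

variable {n : ℕ} {α : Type}

theorem card_supports_le [DecidableEq α] (s : Store n α) (i j : Fin n)
    (hij : IsBifunctional (s.tuples i j)) (b : α) : (s.supports i j b).card ≤ 1 := by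
  rw [Finset.card_le_one]
  intro a ha a' ha'
  simp only [Store.supports, Finset.mem_image, Finset.mem_filter, Prod.exists,
    exists_and_right, exists_eq_right] at ha ha'
  exact hij.2 a a' b ha ha'

/-- The inner loop runs at most once per tuple of `c_jk`. Only the soundness of the result is
recorded, since cardinality bounds and bi-functionality pass to subsets. -/
theorem compose_runs [DecidableEq α] (s : Store n α) (i j k : Fin n)
    (hij : IsBifunctional (s.tuples i j)) :
    Runs (fun s' _ => ∃ r, s.IsComposition i j k r ∧
        s' = Store.setCon { s with acc := r } i k (some r))
      (compose i j k) s (5 * (s.tuples j k).card + 6) := by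
  refine Runs.seq_act (by omega) (Runs.seq ?_)
  refine Runs.forEach_const (fun _ s' => ∃ r, s.IsComposition i j k r ∧ s' = { s with acc := r })
    (fun _ => 4) ?_ ?_ ?_ ?_
  · change ∑ _ ∈ s.tuples j k, _ + 1 ≤ _
    simp only [Finset.sum_const, smul_eq_mul]
    omega
  · exact ⟨∅, fun _ _ h => absurd h (Finset.notMem_empty _), rfl⟩
  · rintro ⟨b, c⟩ R - _ htR - ⟨r, hr, rfl⟩
    change (b, c) ∈ s.tuples j k at htR
    refine Runs.forEach_const
      (fun _ s' => ∃ r, s.IsComposition i j k r ∧ s' = { s with acc := r }) (fun _ => 2) ?_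
      ⟨r, hr, rfl⟩ ?_ fun _ h => h
    · have := card_supports_le s i j hij b
      change ∑ _ ∈ s.supports i j b, _ + 1 ≤ _
      simp only [Finset.sum_const, smul_eq_mul]
      omega
    · rintro a R - _ haS - ⟨r, hr, rfl⟩
      change a ∈ s.supports i j b at haS
      simp only [Store.supports, Finset.mem_image, Finset.mem_filter, Prod.exists,
        exists_and_right, exists_eq_right] at haS
      refine Runs.ite (by omega) (fun hall => Runs.act (by omega)
        ⟨insert (a, c) r, fun a' c' h => ?_, rfl⟩) fun _ => Runs.skip ⟨r, hr, rfl⟩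
      rcases Finset.mem_insert.1 h with h | h
      · cases h
        exact ⟨⟨b, haS, htR⟩, hall⟩
      · exact hr a' c' h
  · rintro _ ⟨r, hr, rfl⟩
    have e : ∑ x ∈ Store.tuples { s with acc := ∅ } j k, (4 + 1) = (s.tuples j k).card * 5 := by
      change ∑ _ ∈ s.tuples j k, _ = _
      simp only [Finset.sum_const, smul_eq_mul]
    rw [e]
    exact ⟨by omega, Runs.seq_act (by omega) (Runs.skip ⟨r, hr, rfl⟩)⟩

/-- The constraints after `j` has been substituted by `i` in `c_jk`. -/
def substCon (C : Fin n → Fin n → Option (Finset (α × α))) (i j k : Fin n)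
    (r : Finset (α × α)) (x y : Fin n) : Option (Finset (α × α)) :=
  if x = i ∧ y = k then some r
  else if x = k ∧ y = i then some (r.map (Equiv.prodComm α α).toEmbedding)
  else if x = j ∧ y = k ∨ x = k ∧ y = j then none
  else C x y

theorem substitute_runs [DecidableEq α] (s : Store n α) {i j k : Fin n} (hne : i ≠ j)
    (hij : IsBifunctional (s.tuples i j)) :
    Runs (fun s' _ => ∃ r, s.IsComposition i j k r ∧ s'.C = substCon s.C i j k r ∧
        s'.func = s.func ∧ s'.O = s.O ∧ s'.elim = s.elim ∧
        s'.L = if (j, k) ∈ s.func then insert k s.L else s.L)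
      (substitute i j k) s (5 * (s.tuples j k).card + 12) := by
  refine Runs.seq ((compose_runs s i j k hij).spec (by omega) ?_)
  rintro _ ⟨r, hr, rfl⟩
  -- Since `i ≠ j`, the two table entries are distinct and the order of the updates is irrelevant.
  have hC : ((Store.setCon { s with acc := r } i k (some r)).setCon j k none).C =
      substCon s.C i j k r := by
    funext x y
    simp only [Store.setCon, substCon, Option.map_none, Option.map_some]
    by_cases h₁ : x = i ∧ y = k
    · have h₂ : ¬ (x = j ∧ y = k) := fun h => hne (h₁.1.symm.trans h.1)
      have h₃ : ¬ (x = k ∧ y = j) := fun h =>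
        hne (h₁.1.symm.trans (h.1.trans (h₁.2.symm.trans h.2)))
      rw [if_neg h₂, if_neg h₃, if_pos h₁, if_pos h₁]
    · by_cases h₂ : x = k ∧ y = i
      · have h₃ : ¬ (x = j ∧ y = k) := fun h =>
          hne (h₂.2.symm.trans (h.2.trans (h₂.1.symm.trans h.1)))
        have h₄ : ¬ (x = k ∧ y = j) := fun h => hne (h₂.2.symm.trans h.2)
        rw [if_neg h₃, if_neg h₄, if_neg h₁, if_pos h₂, if_neg h₁, if_pos h₂]
      · rw [if_neg h₁, if_neg h₂, if_neg h₁, if_neg h₂, ite_or]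
  refine ⟨by omega, Runs.seq_act (by omega) (Runs.seq (Runs.ite (by omega) (fun h =>
    Runs.act (by omega) ⟨by omega, Runs.skip ⟨r, hr, hC, rfl, rfl, rfl, ?_⟩⟩) fun h =>
      Runs.skip ⟨by omega, Runs.skip ⟨r, hr, hC, rfl, rfl, rfl, ?_⟩⟩))⟩
  · change (j, k) ∈ s.func at h
    rw [if_pos h]
    rfl
  · change (j, k) ∉ s.func at h
    rw [if_neg h]
    rfl

/-! ### Invariants of the elimination -/

/-- The functional constraints `F` of a CSP in which functional constraints are bi-functional. -/
structure IsFuncGraph (C₀ : Fin n → Fin n → Option (Finset (α × α)))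
    (F : Finset (Fin n × Fin n)) : Prop where
  bifunctional : ∀ x y, (x, y) ∈ F → ∃ r, C₀ x y = some r ∧ IsBifunctional r
  symm : ∀ x y, (x, y) ∈ F → (y, x) ∈ F
  irrefl : ∀ x, (x, x) ∉ F

/-- The variables outside of `D` have not been touched by the elimination yet. -/
structure ElimInv (C₀ : Fin n → Fin n → Option (Finset (α × α))) (F : Finset (Fin n × Fin n))
    (D : Finset (Fin n)) (s : Store n α) : Prop where
  symm : ∀ x y, s.C y x = (s.C x y).map (Finset.map (Equiv.prodComm α α).toEmbedding)
  self : ∀ x, s.C x x = none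
  func : s.func = F
  orig : ∀ x y, x ∉ D → y ∉ D → s.C x y = C₀ x y

/-- The invariant while the variables reachable from `i` are eliminated: `D₀` are the variables
that have been dealt with before `i`, and the constraints with `Open x y` are still to be looked
at. -/
structure ProcInv (C₀ : Fin n → Fin n → Option (Finset (α × α))) (F : Finset (Fin n × Fin n))
    (D₀ : Finset (Fin n)) (i : Fin n) (D : Finset (Fin n)) (Open : Fin n → Fin n → Prop)
    (s : Store n α) : Prop extends ElimInv C₀ F D s where
  root : i ∈ D
  root' : i ∉ D₀
  subset : D₀ ⊆ D
  isolated : ∀ x y, x ∈ D → x ∉ D₀ → x ≠ i → y ≠ i → ¬ Open x y → s.C x y = none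
  closed : ∀ x y, x ∈ D → x ∉ D₀ → (x, y) ∈ F → y ∈ D ∨ y ∈ s.L ∨ Open x y
  openArc : ∀ x y, Open x y → (x, y) ∈ F → y ∉ D ∧ ∃ r, s.C x y = some r ∧ IsBifunctional r
  work : ∀ x ∈ s.L, x ∉ D ∧ ∃ r, s.C i x = some r ∧ IsBifunctional r

section Invariants

variable {C₀ : Fin n → Fin n → Option (Finset (α × α))} {F : Finset (Fin n × Fin n)}
  {D₀ D : Finset (Fin n)} {i : Fin n} {s s' : Store n α} {Open : Fin n → Fin n → Prop}

/-- By symmetry of `F` and closedness of `D₀`, no functional neighbour of `i` lies in `D₀`, so these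
constraints are still the original ones. -/
theorem ElimInv.start (hF : IsFuncGraph C₀ F) (hcl : ∀ x y, x ∈ D₀ → (x, y) ∈ F → y ∈ D₀)
    (h : ElimInv C₀ F D₀ s) (hi : i ∉ D₀) :
    ProcInv C₀ F D₀ i (insert i D₀) (fun x y => x = i ∧ y ∈ s.nbrs i) { s with L := ∅ } := by
  have hy : ∀ y, (i, y) ∈ F → y ∉ insert i D₀ ∧ ∃ r, s.C i y = some r ∧ IsBifunctional r := by
    intro y hiy
    have hyD : y ∉ D₀ := fun hyD => hi (hcl y i hyD (hF.symm i y hiy))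
    have hyi : y ≠ i := by
      rintro rfl
      exact hF.irrefl _ hiy
    rw [h.orig i y hi hyD]
    exact ⟨by simp [hyD, hyi], hF.bifunctional i y hiy⟩
  refine { symm := h.symm, self := h.self, func := h.func, orig := ?_, root := by simp,
           root' := hi, subset := Finset.subset_insert _ _, isolated := ?_, closed := ?_,
           openArc := ?_, work := ?_ }
  · intro x y hx hy
    exact h.orig x y (fun h => hx (by simp [h])) (fun h => hy (by simp [h]))
  · intro x y hx hx₀ hxi
    simp [hx₀, hxi] at hx
  · intro x y hx hx₀ hxy
    obtain rfl : x = i := by simpa [hx₀] using hx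
    obtain ⟨-, r, hr, -⟩ := hy y hxy
    exact Or.inr (Or.inr ⟨rfl, by simp [Store.mem_nbrs, hr]⟩)
  · rintro x y ⟨rfl, -⟩ hxy
    exact hy y hxy
  · simp

/-- The invariant depends only on the constraints, the functional arcs and the work list, and is
preserved when a constraint that has been looked at is closed. -/
theorem ProcInv.close {Open' : Fin n → Fin n → Prop} (h : ProcInv C₀ F D₀ i D Open s) {y : Fin n}
    (hOpen : ∀ x z, Open x z ↔ x = i ∧ z = y ∨ Open' x z) (hC : s'.C = s.C)
    (hfunc : s'.func = s.func) (hL : s'.L = if (i, y) ∈ F then insert y s.L else s.L) :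
    ProcInv C₀ F D₀ i D Open' s' := by
  have hLs : ∀ x ∈ s.L, x ∈ s'.L := by
    intro x hx
    rw [hL]
    split_ifs <;> simp [hx]
  refine { symm := hC ▸ h.symm, self := hC ▸ h.self, func := hfunc.trans h.func,
           orig := hC ▸ h.orig, root := h.root, root' := h.root', subset := h.subset,
           isolated := ?_, closed := ?_, openArc := ?_, work := ?_ }
  · intro x z hx hx₀ hxi hzi ho
    rw [hC]
    refine h.isolated x z hx hx₀ hxi hzi fun h' => ?_
    rcases (hOpen x z).1 h' with h' | h'
    · exact hxi h'.1
    · exact ho h'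
  · intro x z hx hx₀ hxz
    rcases h.closed x z hx hx₀ hxz with h' | h' | h'
    · exact Or.inl h'
    · exact Or.inr (Or.inl (hLs z h'))
    · rcases (hOpen x z).1 h' with ⟨rfl, rfl⟩ | h'
      · rw [hL, if_pos hxz]
        simp
      · exact Or.inr (Or.inr h')
  · intro x z ho
    rw [hC]
    exact h.openArc x z ((hOpen x z).2 (Or.inr ho))
  · intro x hx
    rw [hC]
    rw [hL] at hx
    split_ifs at hx with hiy
    · rcases Finset.mem_insert.1 hx with rfl | hx
      · exact h.openArc i x ((hOpen i x).2 (Or.inl ⟨rfl, rfl⟩)) hiy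
      · exact h.work x hx
    · exact h.work x hx

/-- Until now `j` was untouched, so its functional constraints with untouched variables are the
original ones; those with variables eliminated earlier are gone. -/
theorem ProcInv.pop (hF : IsFuncGraph C₀ F) (hcl : ∀ x y, x ∈ D₀ → (x, y) ∈ F → y ∈ D₀)
    (h : ProcInv C₀ F D₀ i D (fun _ _ => False) s) {j : Fin n} (hj : j ∈ s.L) :
    ProcInv C₀ F D₀ i (insert j D) (fun x y => x = j ∧ y ∈ (s.nbrs j).erase i)
      { s with L := s.L.erase j } := by
  have hjD := (h.work j hj).1
  have hji : j ≠ i := fun e => hjD (e ▸ h.root)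
  have hjD₀ : j ∉ D₀ := fun e => hjD (h.subset e)
  refine { symm := h.symm, self := h.self, func := h.func, orig := ?_,
           root := by simp [h.root], root' := h.root',
           subset := h.subset.trans (Finset.subset_insert _ _), isolated := ?_, closed := ?_,
           openArc := ?_, work := ?_ }
  · intro x y hx hy
    exact h.orig x y (fun h => hx (by simp [h])) (fun h => hy (by simp [h]))
  · intro x y hx hx₀ hxi hyi ho
    rcases Finset.mem_insert.1 hx with rfl | hx
    · simpa [Store.mem_nbrs, hyi] using ho
    · exact h.isolated x y hx hx₀ hxi hyi id
  · intro x y hx hx₀ hxy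
    by_cases hyD : y ∈ insert j D
    · exact Or.inl hyD
    obtain ⟨hyj, hyD'⟩ : y ≠ j ∧ y ∉ D := by simpa using hyD
    refine Or.inr ?_
    rcases Finset.mem_insert.1 hx with rfl | hx
    · obtain ⟨r, hr, -⟩ := hF.bifunctional x y hxy
      have hyi : y ≠ i := fun e => hyD' (e ▸ h.root)
      rw [← h.orig x y hjD hyD'] at hr
      exact Or.inr ⟨rfl, by simp [Store.mem_nbrs, hr, hyi]⟩
    · rcases h.closed x y hx hx₀ hxy with h' | h' | h'
      · exact absurd h' hyD'
      · exact Or.inl (by simp [h', hyj])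
      · exact h'.elim
  · rintro x y ⟨rfl, hy⟩ hxy
    obtain ⟨hyi, hy⟩ := Finset.mem_erase.1 hy
    rw [Store.mem_nbrs] at hy
    have hyx : y ≠ x := by
      rintro rfl
      exact hF.irrefl _ hxy
    -- If `y ∈ D₀`, closedness would put `j` into `D₀`; otherwise `y` was eliminated by means of `i`
    -- and has kept no constraint with `j`.
    have hyD : y ∉ D := by
      intro hyD
      by_cases hy₀ : y ∈ D₀
      · exact hjD₀ (hcl y x hy₀ (hF.symm x y hxy))
      · rw [h.symm y x, h.isolated y x hyD hy₀ hyi hji id] at hy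
        simp at hy
    refine ⟨by simp [hyx, hyD], ?_⟩
    change ∃ r, s.C x y = some r ∧ _
    rw [h.orig x y hjD hyD]
    exact hF.bifunctional x y hxy
  · intro x hx
    obtain ⟨hxj, hx⟩ := Finset.mem_erase.1 hx
    obtain ⟨hxD, hx⟩ := h.work x hx
    exact ⟨by simp [hxj, hxD], hx⟩

/-- The delicate point is that `c_ik` is bi-functional whenever `k` is in the work list. If `k` was
there before, the new constraint is contained in the old one; if `k` has just entered, it is
contained in a composition of bi-functional constraints. -/
theorem ProcInv.substitute {j k : Fin n} {R : Finset (Fin n)} {hk : k ∉ R}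
    (h : ProcInv C₀ F D₀ i D (fun x y => x = j ∧ y ∈ Finset.cons k R hk) s) (hjD : j ∈ D)
    (hki : k ≠ i) (hji : j ≠ i) (hkj : k ≠ j)
    (hij : IsBifunctional (s.tuples i j)) {r : Finset (α × α)} (hr : s.IsComposition i j k r)
    (hC : s'.C = substCon s.C i j k r) (hfunc : s'.func = s.func)
    (hL : s'.L = if (j, k) ∈ s.func then insert k s.L else s.L) :
    ProcInv C₀ F D₀ i D (fun x y => x = j ∧ y ∈ R) s' := by
  have hLs : ∀ x ∈ s.L, x ∈ s'.L := by
    intro x hx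
    rw [hL]
    split_ifs <;> simp [hx]
  rw [h.func] at hL
  have hCik : s'.C i k = some r := by simp [hC, substCon]
  have hother : ∀ x y, ¬ (x = i ∧ y = k) → ¬ (x = k ∧ y = i) → ¬ (x = j ∧ y = k) →
      ¬ (x = k ∧ y = j) → s'.C x y = s.C x y := by
    intro x y h₁ h₂ h₃ h₄
    rw [hC, substCon, if_neg h₁, if_neg h₂, if_neg (not_or.2 ⟨h₃, h₄⟩)]
  have hnone : ∀ x y, x = j ∧ y = k ∨ x = k ∧ y = j → s'.C x y = none := by
    intro x y hxy
    rw [hC, substCon, if_neg, if_neg, if_pos hxy]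
    · rintro ⟨rfl, rfl⟩
      rcases hxy with ⟨h₁, h₂⟩ | ⟨h₁, h₂⟩
      · exact hkj h₁
      · exact hji h₂.symm
    · rintro ⟨rfl, rfl⟩
      rcases hxy with ⟨h₁, h₂⟩ | ⟨h₁, h₂⟩
      · exact hji h₁.symm
      · exact hki h₁.symm
  refine { symm := ?_, self := ?_, func := hfunc.trans h.func,
           orig := ?_, root := h.root, root' := h.root', subset := h.subset,
           isolated := ?_, closed := ?_, openArc := ?_, work := ?_ }
  · intro x y
    by_cases h₁ : x = i ∧ y = k
    · obtain ⟨rfl, rfl⟩ := h₁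
      rw [hCik, hC, substCon, if_neg (fun h => hki h.1), if_pos ⟨rfl, rfl⟩, Option.map_some]
    · by_cases h₂ : x = k ∧ y = i
      · obtain ⟨rfl, rfl⟩ := h₂
        rw [hCik, hC, substCon, if_neg h₁, if_pos ⟨rfl, rfl⟩, Option.map_some, Finset.map_map]
        congr 1
        ext ⟨a, b⟩
        simp
      · by_cases h₃ : x = j ∧ y = k ∨ x = k ∧ y = j
        · rw [hnone x y h₃, hnone y x (by tauto), Option.map_none]
        · rw [hother x y h₁ h₂ (fun h => h₃ (Or.inl h)) (fun h => h₃ (Or.inr h)),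
            hother y x (fun h => h₂ h.symm) (fun h => h₁ h.symm) (fun h => h₃ (Or.inr h.symm))
              (fun h => h₃ (Or.inl h.symm)), h.symm x y]
  · intro x
    rw [hother x x, h.self x]
    · rintro ⟨rfl, h'⟩; exact hki h'.symm
    · rintro ⟨rfl, h'⟩; exact hki h'
    · rintro ⟨rfl, h'⟩; exact hkj h'.symm
    · rintro ⟨rfl, h'⟩; exact hkj h'
  · intro x y hx hy
    rw [hother x y, h.orig x y hx hy]
    · rintro ⟨rfl, -⟩; exact hx h.root
    · rintro ⟨-, rfl⟩; exact hy h.root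
    · rintro ⟨rfl, -⟩; exact hx hjD
    · rintro ⟨-, rfl⟩; exact hy hjD
  · intro x y hx hx₀ hxi hyi ho
    by_cases h₃ : x = j ∧ y = k ∨ x = k ∧ y = j
    · exact hnone x y h₃
    · rw [hother x y (fun h => hxi h.1) (fun h => hyi h.2) (fun h => h₃ (Or.inl h))
        (fun h => h₃ (Or.inr h))]
      refine h.isolated x y hx hx₀ hxi hyi ?_
      rintro ⟨rfl, hy⟩
      rcases Finset.mem_cons.1 hy with rfl | hy
      · exact h₃ (Or.inl ⟨rfl, rfl⟩)
      · exact ho ⟨rfl, hy⟩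
  · intro x y hx hx₀ hxy
    rcases h.closed x y hx hx₀ hxy with h' | h' | ⟨rfl, hy⟩
    · exact Or.inl h'
    · exact Or.inr (Or.inl (hLs y h'))
    · rcases Finset.mem_cons.1 hy with rfl | hy
      · rw [hL, if_pos hxy]
        simp
      · exact Or.inr (Or.inr ⟨rfl, hy⟩)
  · rintro x y ⟨rfl, hy⟩ hxy
    obtain ⟨hyD, hy'⟩ := h.openArc x y ⟨rfl, Finset.mem_cons.2 (Or.inr hy)⟩ hxy
    rw [hother x y]
    · exact ⟨hyD, hy'⟩
    · exact fun h => hji h.1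
    · exact fun h => hkj h.1.symm
    · rintro ⟨-, rfl⟩; exact hk hy
    · exact fun h => hkj h.1.symm
  · intro x hx
    by_cases hxk : x = k
    · subst hxk
      rw [hCik]
      by_cases hxL : x ∈ s.L
      · obtain ⟨hxD, r₀, hr₀, hb⟩ := h.work x hxL
        exact ⟨hxD, r, rfl, hb.subset fun a b hab => (hr a b hab).2 r₀ hr₀⟩
      · have hjx : (j, x) ∈ F := by
          by_contra hjx
          rw [hL, if_neg hjx] at hx
          exact hxL hx
        obtain ⟨hxD, r₀, hr₀, hb⟩ := h.openArc j x ⟨rfl, Finset.mem_cons_self _ _⟩ hjx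
        exact ⟨hxD, r, rfl, hr.isBifunctional hij (by simpa [Store.tuples, hr₀] using hb)⟩
    · have hxL : x ∈ s.L := by
        rw [hL] at hx
        split_ifs at hx
        · exact (Finset.mem_insert.1 hx).resolve_left hxk
        · exact hx
      obtain ⟨hxD, hx'⟩ := h.work x hxL
      rw [hother i x (fun h => hxk h.2) (fun h => hki h.1.symm) (fun h => hji h.1.symm)
        (fun h => hki h.1.symm)]
      exact ⟨hxD, hx'⟩

end Invariants

/-! ### The running time of the elimination -/

/-- The potential of the untouched variables, which pays for their elimination. -/
def elimPotential (D : Finset (Fin n)) (s : Store n α) : ℕ :=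
  ∑ x ∈ Dᶜ, (20 * conDegree s.C x + 30)

theorem elimPotential_insert {D : Finset (Fin n)} {j : Fin n} (hj : j ∉ D) (s : Store n α) :
    elimPotential (insert j D) s + 20 * conDegree s.C j + 30 = elimPotential D s := by
  rw [elimPotential, elimPotential, ← Finset.add_sum_erase Dᶜ _ (Finset.mem_compl.2 hj),
    Finset.compl_insert]
  omega

/-- Only `x = k` is affected: it loses `c_kj`, whose weight covers that of the new `c_ki`, even if
there was no `c_ki` before. -/
theorem conDegree_substCon_le {C : Fin n → Fin n → Option (Finset (α × α))} {i j k x : Fin n}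
    {r : Finset (α × α)} (hij : i ≠ j) (hki : k ≠ i) (hkj : k ≠ j)
    (hr : r.card + 1 ≤ conWeight (C k j)) (hxi : x ≠ i) (hxj : x ≠ j) :
    conDegree (substCon C i j k r) x ≤ conDegree C x := by
  by_cases hxk : x = k
  · subst hxk
    have key : ∀ C' : Fin n → Fin n → Option (Finset (α × α)), conDegree C' x =
        conWeight (C' x i) + (conWeight (C' x j) +
          ∑ y ∈ (Finset.univ.erase i).erase j, conWeight (C' x y)) := by
      intro C'
      rw [Finset.add_sum_erase (Finset.univ.erase i) (fun y => conWeight (C' x y))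
        (Finset.mem_erase.2 ⟨hij.symm, Finset.mem_univ j⟩),
        Finset.add_sum_erase Finset.univ (fun y => conWeight (C' x y)) (Finset.mem_univ i)]
      rfl
    have h₁ : conWeight (substCon C i j x r x i) = r.card + 1 := by
      simp [substCon, hki, conWeight]
    have h₂ : conWeight (substCon C i j x r x j) = 0 := by
      simp [substCon, hki, hij.symm, conWeight]
    have h₃ : ∑ y ∈ (Finset.univ.erase i).erase j, conWeight (substCon C i j x r x y) =
        ∑ y ∈ (Finset.univ.erase i).erase j, conWeight (C x y) := by
      refine Finset.sum_congr rfl fun y hy => ?_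
      simp only [Finset.mem_erase] at hy
      simp [substCon, hki, hkj, hy.1, hy.2.1]
    rw [key, key, h₁, h₂, h₃]
    omega
  · refine Finset.sum_le_sum fun y _ => ?_
    simp [substCon, hxi, hxj, hxk]

theorem elimPotential_substCon_le {D : Finset (Fin n)} {s s' : Store n α} {i j k : Fin n}
    {r : Finset (α × α)} (hi : i ∈ D) (hj : j ∈ D) (hij : i ≠ j) (hki : k ≠ i) (hkj : k ≠ j)
    (hr : r.card + 1 ≤ conWeight (s.C k j)) (hC : s'.C = substCon s.C i j k r) :
    elimPotential D s' ≤ elimPotential D s := by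
  refine Finset.sum_le_sum fun x hx => ?_
  rw [Finset.mem_compl] at hx
  have := conDegree_substCon_le hij hki hkj hr (x := x) (fun h => hx (h ▸ hi))
    (fun h => hx (h ▸ hj))
  rw [hC]
  omega

theorem conWeight_map_swap (o : Option (Finset (α × α))) :
    conWeight (o.map (Finset.map (Equiv.prodComm α α).toEmbedding)) = conWeight o := by
  cases o <;> simp [conWeight]

variable {C₀ : Fin n → Fin n → Option (Finset (α × α))} {F : Finset (Fin n × Fin n)}
  {D₀ D : Finset (Fin n)} {i j : Fin n} {s : Store n α}

/-- Moving `j` into `D` releases 20 times its current degree, which pays for the substitutions, and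
30 credits for the overhead. Up to 10 of the latter are left to the caller, whence `T + 10`. -/
theorem eliminate_runs [DecidableEq α] (hF : IsFuncGraph C₀ F)
    (hcl : ∀ x y, x ∈ D₀ → (x, y) ∈ F → y ∈ D₀)
    (h : ProcInv C₀ F D₀ i D (fun _ _ => False) s) (hj : j ∈ s.L)
    {Q : Store n α → ℕ → Prop} {T X : ℕ} (hT : elimPotential D s + X ≤ T + 10)
    (hQ : ∀ s' t, ProcInv C₀ F D₀ i (insert j D) (fun _ _ => False) s' → s'.O = s.O →
      s'.elim = insert j s.elim → elimPotential (insert j D) s' + X ≤ t → Q s' t) :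
    Runs Q (block [
      act (fun s => { s with L := s.L.erase j }),
      forEach (fun s => (s.nbrs j).erase i) (fun k => substitute i j k),
      act (fun s => { s with elim := insert j s.elim })]) s T := by
  obtain ⟨hjD, r₀, hr₀, hb₀⟩ := h.work j hj
  have hji : j ≠ i := fun e => hjD (e ▸ h.root)
  have hpot := elimPotential_insert hjD s
  have hsum : ∑ k ∈ (s.nbrs j).erase i, 20 * conWeight (s.C j k) ≤ 20 * conDegree s.C j := by
    rw [conDegree, Finset.mul_sum]
    exact Finset.sum_le_sum_of_subset (Finset.subset_univ _)
  refine Runs.seq_act (by omega) (Runs.seq ?_)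
  -- A substitution changes neither `c_ij` nor the constraints of `j` still to be substituted, so
  -- the weights reserved on entry remain correct.
  refine Runs.forEach (fun R s' t => ProcInv C₀ F D₀ i (insert j D) (fun x y => x = j ∧ y ∈ R) s' ∧
    IsBifunctional (s'.tuples i j) ∧ (∀ k ∈ R, s'.C j k = s.C j k) ∧ s'.O = s.O ∧
    s'.elim = s.elim ∧
    elimPotential (insert j D) s' + ∑ k ∈ R, 20 * conWeight (s.C j k) + 3 + X ≤ t) (by omega)
    ⟨h.pop hF hcl hj, ?_, fun _ _ => rfl, rfl, rfl, ?_⟩ ?_ ?_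
  · change IsBifunctional (s.tuples i j)
    simpa [Store.tuples, hr₀] using hb₀
  · change elimPotential (insert j D) s + ∑ k ∈ (s.nbrs j).erase i, _ + _ + X ≤ _
    omega
  · rintro k R hk s' t hkS - ⟨h', hij, hR, hO, hE, ht⟩
    change k ∈ (s.nbrs j).erase i at hkS
    obtain ⟨hki, hkn⟩ := Finset.mem_erase.1 hkS
    have hjk : s'.C j k = s.C j k := hR k (Finset.mem_cons_self _ _)
    rw [Store.mem_nbrs, ← hjk] at hkn
    have hkj : k ≠ j := by
      rintro rfl
      rw [h'.self] at hkn
      simp at hkn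
    have hw := Store.conWeight_eq_of_mem_nbrs (Store.mem_nbrs.2 hkn)
    have hwk : conWeight (s'.C k j) = conWeight (s'.C j k) := by
      rw [h'.symm j k, conWeight_map_swap]
    rw [Finset.sum_cons, ← hjk, hw] at ht
    refine (substitute_runs s' hji.symm hij).spec (by omega) ?_
    rintro s'' ⟨r, hr, hC, hfunc, hO', hE', hL⟩
    have hcard := hr.card_le hij
    have hpot' := elimPotential_substCon_le (D := insert j D) (s' := s'') h'.root (by simp)
      hji.symm hki hkj (by omega : r.card + 1 ≤ conWeight (s'.C k j)) hC
    refine ⟨by omega, h'.substitute (by simp) hki hji hkj hij hr hC hfunc hL, ?_, ?_,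
      hO'.trans hO, hE'.trans hE, by omega⟩
    · have : s''.tuples i j = s'.tuples i j := by
        simp [Store.tuples, hC, substCon, hkj.symm, hki.symm, hji.symm]
      rwa [this]
    · intro l hl
      have hlk : l ≠ k := fun e => hk (e ▸ hl)
      rw [hC, substCon, if_neg (fun h => hji h.1), if_neg (fun h => hkj h.1.symm), if_neg,
        hR l (Finset.mem_cons.2 (Or.inr hl))]
      rintro (h | h)
      · exact hlk h.2
      · exact hkj h.1.symm
  · rintro s' t ⟨h', -, -, hO, hE, ht⟩
    rw [Finset.sum_empty] at ht
    refine ⟨by omega, Runs.seq_act (by omega) (Runs.skip (hQ _ _ ?_ hO (by simp [hE]) ?_))⟩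
    · simp only [Finset.notMem_empty, and_false] at h'
      exact { h' with }
    · change elimPotential (insert j D) s' + X ≤ _
      omega

theorem process_runs [DecidableEq α] (hF : IsFuncGraph C₀ F)
    (hcl : ∀ x y, x ∈ D₀ → (x, y) ∈ F → y ∈ D₀) (h : ElimInv C₀ F D₀ s) (hi : i ∉ D₀)
    {Q : Store n α → ℕ → Prop} {T X : ℕ} (hT : elimPotential D₀ s + X ≤ T)
    (hQ : ∀ s' t D, ElimInv C₀ F D s' → (∀ x y, x ∈ D → (x, y) ∈ F → y ∈ D) → s'.O = s.O →
      s.elim ⊆ s'.elim → (∀ x ∈ D, x ∉ D₀ → x ≠ i → x ∈ s'.elim) →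
      elimPotential D s' + X ≤ t → Q s' t) :
    Runs Q (process i) s T := by
  have hpot := elimPotential_insert hi s
  have hsum : ∑ k ∈ s.nbrs i, 20 ≤ 20 * conDegree s.C i := by
    refine le_trans ?_ (Nat.mul_le_mul_left 20 (s.sum_nbrs_le i))
    rw [Finset.mul_sum]
    exact Finset.sum_le_sum fun k _ => by omega
  refine Runs.seq_act (by omega) (Runs.seq ?_)
  refine Runs.forEach (fun R s' t =>
    ProcInv C₀ F D₀ i (insert i D₀) (fun x y => x = i ∧ y ∈ R) s' ∧ s'.C = s.C ∧ s'.O = s.O ∧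
    s'.elim = s.elim ∧ elimPotential (insert i D₀) s + ∑ k ∈ R, 20 + 10 + X ≤ t) (by omega)
    ⟨h.start (s := s) hF hcl hi, rfl, rfl, rfl, ?_⟩ ?_ ?_
  · change _ + ∑ k ∈ s.nbrs i, 20 + 10 + X ≤ _
    omega
  · rintro y R hy s' t - - ⟨h', hC, hO, hE, ht⟩
    rw [Finset.sum_cons] at ht
    have hOpen : ∀ x z, x = i ∧ z ∈ Finset.cons y R hy ↔ x = i ∧ z = y ∨ x = i ∧ z ∈ R := by
      intro x z
      rw [Finset.mem_cons, and_or_left]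
    refine Runs.ite (by omega) (fun hF => Runs.act (by omega) ⟨by omega, ?_, hC, hO, hE, by omega⟩)
      fun hF => Runs.skip ⟨by omega, ?_, hC, hO, hE, by omega⟩
    · change (i, y) ∈ s'.func at hF
      rw [h'.func] at hF
      exact h'.close hOpen rfl rfl (by rw [if_pos hF])
    · change (i, y) ∉ s'.func at hF
      rw [h'.func] at hF
      exact h'.close hOpen rfl rfl (by rw [if_neg hF])
  · rintro s' t ⟨h', hC, hO, hE, ht⟩
    refine ⟨by omega, Runs.seq (Runs.loop (fun s' t => ∃ D,
      ProcInv C₀ F D₀ i D (fun _ _ => False) s' ∧ s'.O = s.O ∧ s.elim ⊆ s'.elim ∧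
      (∀ x ∈ D, x ∉ D₀ → x ≠ i → x ∈ s'.elim) ∧ elimPotential D s' + 5 + X ≤ t)
      ⟨insert i D₀, ?_, hO, hE.ge, ?_, ?_⟩ ?_ ?_)⟩
    · simpa only [Finset.notMem_empty, and_false] using h'
    · intro x hx hx₀ hxi
      simp [hx₀, hxi] at hx
    · simp only [elimPotential, hC] at ht ⊢
      omega
    · rintro s₁ t₁ ⟨D, h₁, hO₁, hE₁, hD₁, ht₁⟩ hne
      refine ⟨by omega, Runs.pick (by omega) hne fun j hj => ?_⟩
      refine eliminate_runs hF hcl h₁ hj (X := X + 6) (by omega) ?_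
      intro s₂ t₂ h₂ hO₂ hE₂ ht₂
      refine ⟨by omega, insert j D, h₂, hO₂.trans hO₁, ?_, ?_, by omega⟩
      · rw [hE₂]
        exact hE₁.trans (Finset.subset_insert _ _)
      · intro x hx hx₀ hxi
        rw [hE₂, Finset.mem_insert]
        exact (Finset.mem_insert.1 hx).imp id fun hx => hD₁ x hx hx₀ hxi
    · rintro s₁ t₁ ⟨D, h₁, hO₁, hE₁, hD₁, ht₁⟩ hne
      refine ⟨by omega, by omega, Runs.skip (hQ s₁ _ D h₁.toElimInv ?_ hO₁ hE₁ hD₁ (by omega))⟩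
      intro x y hx hxy
      by_cases hx₀ : x ∈ D₀
      · exact h₁.subset (hcl x y hx₀ hxy)
      · rcases h₁.closed x y hx hx₀ hxy with h | h | h
        · exact h
        · exact absurd ⟨y, h⟩ hne
        · exact h.elim

/-! ### The running time of the algorithm -/

/-- Each constraint is counted at both of its ends. -/
theorem sum_conDegree_le (P : CSP n α) : ∑ i, conDegree P.con i + 2 * n ≤ 2 * P.size := by
  have hlt : ∀ p : Fin n × Fin n, conWeight (P.con p.1 p.2) =
      (if p.1 < p.2 then conWeight (P.con p.1 p.2) else 0) +
      (if p.2 < p.1 then conWeight (P.con p.2 p.1) else 0) := by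
    rintro ⟨i, j⟩
    rcases lt_trichotomy i j with h | h | h
    · simp [h, h.not_gt]
    · subst h
      simp [P.con_self, conWeight]
    · simp [h, h.not_gt, P.con_symm j i, conWeight_map_swap]
  have hswap : ∑ p : Fin n × Fin n, (if p.2 < p.1 then conWeight (P.con p.2 p.1) else 0) =
      ∑ p : Fin n × Fin n, (if p.1 < p.2 then conWeight (P.con p.1 p.2) else 0) :=
    (Equiv.prodComm (Fin n) (Fin n)).sum_comp
      fun p => if p.1 < p.2 then conWeight (P.con p.1 p.2) else 0
  have hsum : ∑ i, conDegree P.con i = ∑ p : Fin n × Fin n, conWeight (P.con p.1 p.2) := by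
    rw [Fintype.sum_prod_type]
    rfl
  have hsize : P.size =
      n + ∑ p : Fin n × Fin n, (if p.1 < p.2 then conWeight (P.con p.1 p.2) else 0) := by
    rw [CSP.size, Finset.sum_filter]
    rfl
  rw [hsum, Finset.sum_congr rfl fun p _ => hlt p, Finset.sum_add_distrib, hswap, hsize]
  omega

theorem isFuncGraph (P : CSP n α)
    (hP : ∀ i j r, P.con i j = some r → IsFunctional r → IsBifunctional r)
    {F : Finset (Fin n × Fin n)}
    (hF : ∀ i j, (i, j) ∈ F ↔ ∃ r, P.con i j = some r ∧ IsFunctional r) :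
    IsFuncGraph P.con F where
  bifunctional x y hxy := by
    obtain ⟨r, hr, hfun⟩ := (hF x y).1 hxy
    exact ⟨r, hr, hP x y r hr hfun⟩
  symm x y hxy := by
    obtain ⟨r, hr, hfun⟩ := (hF x y).1 hxy
    refine (hF y x).2 ⟨_, by rw [P.con_symm x y, hr, Option.map_some], fun a b b' h h' => ?_⟩
    refine (hP x y r hr hfun).2 b b' a ?_ ?_
    · simpa using h
    · simpa using h'
  irrefl x hx := by
    obtain ⟨r, hr, -⟩ := (hF x x).1 hx
    rw [P.con_self] at hr
    exact Option.some_ne_none r hr.symm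

/-- Every functional arc is a constraint of weight at least one, so this bounds the cost of the
depth-first searches by the size. -/
theorem card_adjacent_le {F : Finset (Fin n × Fin n)} (hF : IsFuncGraph C₀ F) (v : Fin n)
    (S : Finset (Fin n)) (hS : ∀ w ∈ S, (v, w) ∈ F) : S.card ≤ conDegree C₀ v := by
  rw [Finset.card_eq_sum_ones]
  refine le_trans (Finset.sum_le_sum fun w hw => ?_)
    (Finset.sum_le_sum_of_subset (f := fun w => conWeight (C₀ v w)) (Finset.subset_univ S))
  obtain ⟨r, hr, -⟩ := hF.bifunctional v w (hS w hw)
  simp [hr, conWeight]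

theorem eliminationLoop_runs [DecidableEq α] (hF : IsFuncGraph C₀ F) (h : ElimInv C₀ F ∅ s)
    (hO : s.O.Nodup) :
    Runs (fun _ _ => True)
      (loop (fun s => s.O ≠ []) (
        pick (fun s => {i | s.O.head? = some i}) fun i =>
          block [
            act (fun s => { s with O := s.O.tail }),
            Prog.ite (fun s => i ∈ s.elim) skip (process i)])) s
      (20 * ∑ i, conDegree s.C i + 40 * n + 1) := by
  have hlen : s.O.length ≤ n := by simpa using hO.length_le_card
  have hpot : elimPotential ∅ s = 20 * ∑ i, conDegree s.C i + 30 * n := by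
    simp only [elimPotential, Finset.compl_empty, Finset.sum_add_distrib, ← Finset.mul_sum,
      Finset.sum_const, Finset.card_univ, Fintype.card_fin, smul_eq_mul]
    omega
  -- A touched variable is either marked as eliminated or a former root, which has left the
  -- repetition-free list `O`. An unmarked head of `O` is therefore untouched.
  refine Runs.loop (fun s t => ∃ D, ElimInv C₀ F D s ∧ (∀ x y, x ∈ D → (x, y) ∈ F → y ∈ D) ∧
    s.O.Nodup ∧ (∀ x ∈ D, x ∉ s.elim → x ∉ s.O) ∧
    elimPotential D s + 10 * s.O.length + 1 ≤ t) ⟨∅, h, by simp, hO, by simp, by omega⟩ ?_ ?_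
  · rintro s₁ t ⟨D, h₁, hcl, hO₁, hD, ht⟩ hne
    obtain ⟨i, l, hil⟩ := List.exists_cons_of_ne_nil hne
    rw [hil] at hO₁ hD ht
    rw [List.length_cons] at ht
    obtain ⟨hi, hl⟩ := List.nodup_cons.1 hO₁
    refine ⟨by omega, Runs.pick (by omega) ⟨i, by simp [hil]⟩ fun i' hi' => ?_⟩
    obtain rfl : i = i' := by simpa [hil, eq_comm] using hi'
    refine Runs.seq_act (by omega) (Runs.seq (Runs.ite (by omega) (fun hiE => ?_) fun hiE => ?_))
    · refine Runs.skip ⟨by omega, Runs.skip ⟨by omega, D, ⟨h₁.symm, h₁.self, h₁.func, h₁.orig⟩,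
        hcl, ?_, ?_, ?_⟩⟩
      · change s₁.O.tail.Nodup
        rwa [hil]
      · intro x hx hxE
        change x ∉ s₁.O.tail
        rw [hil]
        exact fun hxl => hD x hx hxE (List.mem_cons_of_mem _ hxl)
      · change elimPotential D s₁ + 10 * s₁.O.tail.length + 1 ≤ _
        rw [hil, List.tail_cons]
        omega
    · have hiD : i ∉ D := fun hiD => hD i hiD hiE List.mem_cons_self
      refine process_runs (s := { s₁ with O := s₁.O.tail }) (X := 10 * l.length + 3) hF hcl
        ⟨h₁.symm, h₁.self, h₁.func, h₁.orig⟩ hiD ?_ ?_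
      · change elimPotential D s₁ + _ ≤ _
        omega
      · intro s₂ t₂ D' h₂ hcl₂ hO₂ hE₂ hD₂ ht₂
        have hO₂ : s₂.O = l := by
          rw [hO₂]
          simp [hil]
        refine ⟨by omega, Runs.skip ⟨by omega, D', h₂, hcl₂, hO₂ ▸ hl, ?_, ?_⟩⟩
        · intro x hx hxE
          rw [hO₂]
          intro hxl
          by_cases hxD : x ∈ D
          · exact hD x hxD (fun h => hxE (hE₂ h)) (List.mem_cons_of_mem _ hxl)
          · exact hxE (hD₂ x hx hxD fun e => hi (e ▸ hxl))
        · rw [hO₂]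
          omega
  · rintro s₁ t ⟨D, -, -, -, -, ht⟩ -
    exact ⟨by omega, trivial⟩

theorem algorithm_runs [DecidableEq α] (P : CSP n α)
    (hP : ∀ i j r, P.con i j = some r → IsFunctional r → IsBifunctional r) :
    Runs (fun _ _ => True) (algorithm (n := n) (α := α)) (Store.initial P)
      (200 * (P.size + 1)) := by
  have hsize := sum_conDegree_le P
  refine Runs.seq ((markFunctional_runs (Store.initial P) rfl).spec ?_ ?_)
  · change 8 * ∑ i, conDegree P.con i + 2 * n + 1 ≤ _
    omega
  rintro s₁ ⟨hC₁, -, hS₁, hF₁⟩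
  change s₁.C = P.con at hC₁
  change ∀ i j, _ ↔ ∃ r, P.con i j = some r ∧ _ at hF₁
  have e : conDegree (Store.initial P).C = conDegree P.con := rfl
  rw [e]
  have hF := isFuncGraph P hP hF₁
  refine ⟨by omega, Runs.seq ((findOrdering_runs s₁ hS₁ (conDegree P.con)
    (fun v => card_adjacent_le hF v _ fun w hw => ?_)
    (fun v => card_adjacent_le hF v _ fun w hw => ?_)).spec (by omega) ?_)⟩
  · simpa [Store.succs] using hw
  · exact hF.symm _ _ (by simpa [Store.preds] using hw)
  rintro s₂ ⟨hC₂, -, hF₂, hO₂⟩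
  refine ⟨by omega, Runs.seq (Runs.forEach_const (fun _ s' => s'.C = P.con ∧
    s'.func = s₁.func ∧ s'.O.Nodup) (fun _ => 1) ?_ ⟨hC₂.trans hC₁, hF₂, hO₂⟩
    ?_ ?_)⟩
  · simp only [Finset.sum_const, Finset.card_univ, Fintype.card_fin, smul_eq_mul]
    omega
  · rintro i R - s' - - ⟨hC, hF, hO⟩
    exact Runs.act le_rfl ⟨hC, hF, hO⟩
  · rintro s₃ ⟨hC₃, hF₃, hO₃⟩
    simp only [Finset.sum_const, Finset.card_univ, Fintype.card_fin, smul_eq_mul]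
    refine ⟨by omega, Runs.seq ((eliminationLoop_runs hF
      ⟨hC₃ ▸ P.con_symm, hC₃ ▸ P.con_self, hF₃, fun x y _ _ => by rw [hC₃]⟩ hO₃).spec ?_
      fun _ _ => ⟨?_, Runs.skip trivial⟩)⟩
    · rw [hC₃]; omega
    · rw [hC₃]; omega

end LinearElimination

theorem mainTheorem9 :
    ∃ K : ℕ, ∀ (n : ℕ) (α : Type) [DecidableEq α],
      (∀ (s : Store n α) (i j k : Fin n), IsBifunctional (s.tuples i j) →
        (LinearElimination.compose i j k).HaltsWithin s
          (K * ((s.tuples i j).card + (s.tuples j k).card + 1))) ∧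
      (∀ P : CSP n α,
        (∀ i j r, P.con i j = some r → IsFunctional r → IsBifunctional r) →
        (LinearElimination.algorithm (n := n) (α := α)).HaltsWithin (Store.initial P)
          (K * (P.size + 1))) :=
  ⟨200, fun _ _ _ =>
    ⟨fun s i j k h => ((LinearElimination.compose_runs s i j k h).mono (by omega)).haltsWithin,
      fun P hP => (LinearElimination.algorithm_runs P hP).haltsWithin⟩⟩
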